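/- Let $G=(V,E)$ be a finite directed acyclic graph (parallel edges allowed). For an edge $e$ write $t(e)$ for its tail and $h(e)$ for its head; a source (sink) is a vertex with no incoming (outgoing) edges, and the other vertices are internal. Let $\mathbf a\in\mathbb Z^V$ be a conservationist netflow vector: $\mathbf a_i=1$ for each source $i$, $\mathbf a_i<0$ for each sink $i$, and $\mathbf a_i=0$ for each internal vertex $i$. Let $\mathcal F$ be a framing of $(G,\mathbf a)$: a total order on the outgoing edges of each non-sink vertex, a total order on the incoming edges of each internal vertex, and a total order $<_{\mathrm{src}}$ on the sources. For real $x$, an $x\times\mathbf a$-flow is a function $F:E\to\mathbb R_{\ge 0}$ such that $\sum_{t(e)=i}F(e)-\sum_{h(e)=i}F(e)=x\,\mathbf a_i$ for all $i\in V$. A route is a path from a source to a sink; its indicator vector $\mathcal I(p)\in\mathbb R^E$ has entry $1$ at the edges of $p$ and $0$ elsewhere. For distinct paths $p,q$ from a vertex $i$ to sinks, with maximal common initial subpath $\sigma$, write $p<_i^+q$ if the edge of $p$ following $\sigma$ precedes the edge of $q$ following $\sigma$ in the order on the outgoing edges of the last vertex of $\sigma$ (which is $i$ if $\sigma$ has no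 edges). Dually, for $i$ not a sink and distinct paths $p,q$ from sources to $i$, with maximal common final subpath $\sigma$, write $p<_i^-q$ if the edge of $p$ preceding $\sigma$ precedes the edge of $q$ preceding $\sigma$ in the order on the incoming edges of the first vertex of $\sigma$. Two routes $p,q$ through a common vertex $i$ are incompatible at $i$ if, up to exchanging $p$ and $q$, the part of $p$ before $i$ is $<_i^-$ that of $q$ while the part of $q$ after $i$ is $<_i^+$ that of $p$; routes are compatible if they are not incompatible at any common vertex. A route-clique is a set of pairwise compatible routes. A layering is a set $L$ of routes containing exactly one route $L_i$ beginning at each source $i$, and exactly $|\mathbf a_j|$ routes ending at each sink $j$. Put $\mathcal J(L)=\sum_{p\in L}\mathcal I(p)$. For distinct layerings $L,M$ write $L<_{\mathrm{src}}^+M$ if $L_i<_i^+M_i$, where $i$ is the $<_{\mathrm{src}}$-maximal source with $L_i\ne M_i$; this is a total order on layerings. For a set $\mathcal L$ of layerings let $\mathrm{routes}(\mathcal L)=\bigcup_{L\in\mathcal L}L$. A set $\mathcal L=\{L^1<_{\mathrm{src}}^+\dots<_{\mathrm{src}}^+L^m\}$ of layerings ($m\ge 0$) is a layering-simplex if 1.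 $\mathrm{routes}(\mathcal L)$ is a route-clique; 2. for every $i\in[m]$, $L^i$ is the $<_{\mathrm{src}}^+$-minimum of the layerings $L$ with $L\subseteq\mathrm{routes}(\{L^i,\dots,L^m\})$; 3. for every $i\in[m]$, some route of $L^i$ is not in $\mathrm{routes}(\{L^{i+1},\dots,L^m\})$. **Theorem.** Let $x>0$ and let $F$ be an $x\times\mathbf a$-flow of $G$. Then there is exactly one pair consisting of a layering-simplex $\mathcal L$ and positive real coefficients $(a_L)_{L\in\mathcal L}$ such that $$F=\sum_{L\in\mathcal L}a_L\,\mathcal J(L).$$ Moreover, if $F$ is integer-valued, then all the coefficients $a_L$ are integers. -/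

import Mathlib

/-- A directed graph with vertices `V` and edges `E`; parallel edges are allowed. -/
structure DiMultigraph (V E : Type*) where
  tail : E → V
  head : E → V

namespace DiMultigraph

variable {V E : Type*}

/-- `G` has no oriented cycle (a directed acyclic graph). -/
def IsAcyclic (G : DiMultigraph V E) : Prop :=
  ∀ v, ¬ Relation.TransGen (fun u w => ∃ e, G.tail e = u ∧ G.head e = w) v v

/-- A source is a vertex with no incoming edges. -/
def IsSource (G : DiMultigraph V E) (v : V) : Prop := ∀ e, G.head e ≠ v

/-- A sink is a vertex with no outgoing edges. -/
def IsSink (G : DiMultigraph V E) (v : V) : Prop := ∀ e, G.tail e ≠ v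

/-- An internal vertex is one that is neither a source nor a sink. -/
def IsInternal (G : DiMultigraph V E) (v : V) : Prop := ¬ G.IsSource v ∧ ¬ G.IsSink v

/-- `F` is a nonnegative flow on `G` with (real) netflow vector `b`. -/
def IsFlow [Fintype E] [DecidableEq V] (G : DiMultigraph V E) (b : V → ℝ) (F : E → ℝ) : Prop :=
  (∀ e, 0 ≤ F e) ∧
    ∀ v, (∑ e with G.tail e = v, F e) - (∑ e with G.head e = v, F e) = b v

/-- A conservationist netflow vector: `1` at sources, negative at sinks, `0` at internal vertices. -/
structure IsConservationist (G : DiMultigraph V E) (a : V → ℤ) : Prop where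
  source : ∀ v, G.IsSource v → a v = 1
  sink : ∀ v, G.IsSink v → a v < 0
  internal : ∀ v, G.IsInternal v → a v = 0

/-- A framing: strict total orders on the outgoing edges of each non-sink vertex, on the incoming
edges of each internal vertex, and on the set of sources. (The values of the relations elsewhere
are irrelevant.) -/
structure Framing (G : DiMultigraph V E) where
  outLt : V → E → E → Prop
  inLt : V → E → E → Prop
  srcLt : V → V → Prop
  outLt_total : ∀ v, ¬ G.IsSink v →
    IsStrictTotalOrder {e : E // G.tail e = v} (fun e f => outLt v e f)
  inLt_total : ∀ v, G.IsInternal v →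
    IsStrictTotalOrder {e : E // G.head e = v} (fun e f => inLt v e f)
  srcLt_total : IsStrictTotalOrder {v : V // G.IsSource v} (fun v w => srcLt v w)

/-- `G.IsPath u l w`: the list of edges `l` is a directed path from `u` to `w`. -/
inductive IsPath (G : DiMultigraph V E) : V → List E → V → Prop
  | nil (v : V) : IsPath G v [] v
  | cons (e : E) {l : List E} {w : V} (h : IsPath G (G.head e) l w) : IsPath G (G.tail e) (e :: l) w

/-- A route is a path from a source to a sink. -/
@[ext]
structure Route (G : DiMultigraph V E) where
  src : V
  edges : List E
  snk : V
  isPath : G.IsPath src edges snk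
  isSource : G.IsSource src
  isSink : G.IsSink snk

open Classical in
/-- The indicator vector of a route. -/
noncomputable def Route.indicator {G : DiMultigraph V E} (p : G.Route) : E → ℝ :=
  fun e => if e ∈ p.edges then 1 else 0

/-- The indicator vector of a finite set of routes. -/
noncomputable def layeringIndicator {G : DiMultigraph V E} (L : Finset G.Route) : E → ℝ :=
  ∑ p ∈ L, p.indicator

open Classical in
/-- A layering: a set of routes, exactly one of which begins at each source `i`, and exactly
`|a j|` of which end at each sink `j`. -/
structure IsLayering (G : DiMultigraph V E) (a : V → ℤ) (L : Finset G.Route) : Prop where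
  source : ∀ i, G.IsSource i → (L.filter fun p => p.src = i).card = 1
  sink : ∀ j, G.IsSink j → ((L.filter fun p => p.snk = j).card : ℤ) = |a j|

/-- The set of routes used by the members of a family of layerings. -/
def routesOf {G : DiMultigraph V E} (𝓛 : Set (Finset G.Route)) : Set G.Route :=
  {p | ∃ L ∈ 𝓛, p ∈ L}

namespace Framing

variable {G : DiMultigraph V E} (𝓕 : G.Framing)

/-- The post-order on paths (edge lists) that leave a common vertex and end in sinks: after the
maximal common initial subpath `σ`, the paths continue by `f` and `g` with `f` below `g` in the
order of outgoing edges. (As that order is irreflexive, `f ≠ g`, so `σ` is indeed maximal.) -/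
def PostLt (p q : List E) : Prop :=
  ∃ (σ p' q' : List E) (f g : E),
    p = σ ++ f :: p' ∧ q = σ ++ g :: q' ∧ 𝓕.outLt (G.tail f) f g

/-- The pre-order on paths (edge lists) that start in sources and end in a common non-sink vertex,
dual to `PostLt`. -/
def PreLt (p q : List E) : Prop :=
  ∃ (σ p' q' : List E) (f g : E),
    p = p' ++ f :: σ ∧ q = q' ++ g :: σ ∧ 𝓕.inLt (G.head f) f g

/-- `p` and `q` both pass through `i`, with `p` before `q` in the pre-`i` order and `q` before `p`
in the post-`i` order. -/
def CrossAt (i : V) (p q : G.Route) : Prop :=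
  ∃ p₁ p₂ q₁ q₂ : List E,
    p.edges = p₁ ++ p₂ ∧ G.IsPath p.src p₁ i ∧ G.IsPath i p₂ p.snk ∧
    q.edges = q₁ ++ q₂ ∧ G.IsPath q.src q₁ i ∧ G.IsPath i q₂ q.snk ∧
    𝓕.PreLt p₁ q₁ ∧ 𝓕.PostLt q₂ p₂

/-- Two routes are compatible if they are not incompatible at any shared vertex. -/
def Compatible (p q : G.Route) : Prop :=
  ∀ i, ¬ 𝓕.CrossAt i p q ∧ ¬ 𝓕.CrossAt i q p

/-- A route-clique is a set of pairwise compatible routes. -/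
def IsRouteClique (R : Set G.Route) : Prop := R.Pairwise 𝓕.Compatible

/-- The post-source order on layerings: at the maximal source where the routes of `L` and `M`
differ, the route `p` of `L` is below the route `q` of `M` in the post-order. -/
def LayeringLt (L M : Finset G.Route) : Prop :=
  ∃ p ∈ L, ∃ q ∈ M, p.src = q.src ∧ 𝓕.PostLt p.edges q.edges ∧
    ∀ p' ∈ L, ∀ q' ∈ M, p'.src = q'.src → 𝓕.srcLt p.src p'.src → p' = q'

/-- A layering-simplex. If `𝓛 = {L¹ < ⋯ < Lᵐ}` in the post-source order and `L = Lⁱ`, then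
`{K ∈ 𝓛 | K = L ∨ L < K}` is `{Lⁱ, …, Lᵐ}` and `{K ∈ 𝓛 | L < K}` is `{Lⁱ⁺¹, …, Lᵐ}`. -/
structure IsLayeringSimplex (a : V → ℤ) (𝓛 : Finset (Finset G.Route)) : Prop where
  isLayering : ∀ L ∈ 𝓛, G.IsLayering a L
  clique : 𝓕.IsRouteClique (routesOf (𝓛 : Set (Finset G.Route)))
  isMin : ∀ L ∈ 𝓛, ∀ M : Finset G.Route, G.IsLayering a M →
    (M : Set G.Route) ⊆ routesOf {K | K ∈ 𝓛 ∧ (K = L ∨ 𝓕.LayeringLt L K)} →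
    L = M ∨ 𝓕.LayeringLt L M
  exists_new : ∀ L ∈ 𝓛, ∃ p ∈ L, p ∉ routesOf {K | K ∈ 𝓛 ∧ 𝓕.LayeringLt L K}

/-- `F = ∑_{L ∈ 𝓛} c_L J(L)` is a positive layering-simplex combination
(only the values of `c` on `𝓛` matter). -/
structure IsPositiveCombination (a : V → ℤ) (F : E → ℝ)
    (𝓛 : Finset (Finset G.Route)) (c : Finset G.Route → ℝ) : Prop where
  simplex : 𝓕.IsLayeringSimplex a 𝓛
  pos : ∀ L ∈ 𝓛, 0 < c L
  eq_sum : F = ∑ L ∈ 𝓛, c L • layeringIndicator L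

end Framing

end DiMultigraph

/-!
Stack the flow through each internal vertex in two ways, by the order of the incoming and of the
outgoing edges. A height in the flow of an edge then continues along a well-defined route, and the
heights that follow a route `p` form an interval whose length `w p` is a piecewise linear function
of `F` with integer coefficients. Compatible routes leave each common vertex in the order in which
they enter it, so a decomposition of `F` over a route-clique has to follow this stacking: `w` is the
only one.

It remains to group the routes into layerings. The total weight is `x` at every source and
`x * |a j|` at every sink `j`, so by Hall's marriage theorem the support of `w` contains a layering
unless it is empty. Subtracting the largest possible multiple of the least such layering and repeating with
the rest yields a layering-simplex. Conversely the first layering of a layering-simplex is the least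
one inside the union of all its layerings, and its coefficient is the least weight on its routes,
because one of its routes lies in no later layering; hence both are determined by `w`.
-/

namespace DiMultigraph

/-! ### Stacks, overlaps and masses -/

section Stack

theorem sum_sub_telescope_of_linearOrder {α M N : Type*} [LinearOrder α] [AddCommMonoid M]
    [AddCommGroup N] (F : α → M) (χ : M → N) (S : Finset α) :
    ∑ e ∈ S, (χ ((∑ f ∈ S with f < e, F f) + F e) - χ (∑ f ∈ S with f < e, F f)) =
      χ (∑ e ∈ S, F e) - χ 0 := by
  induction S using Finset.induction_on_max with
  | empty => simp
  | insert m S hm ih =>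
    have hmS : m ∉ S := fun h => lt_irrefl m (hm m h)
    have below_max : {f ∈ insert m S | f < m} = S := by
      rw [Finset.filter_insert, if_neg (lt_irrefl m), Finset.filter_true_of_mem hm]
    have below : ∀ e ∈ S, {f ∈ insert m S | f < e} = {f ∈ S | f < e} := fun e he => by
      rw [Finset.filter_insert, if_neg (hm e he).not_gt]
    have lower : ∑ e ∈ S, (χ ((∑ f ∈ insert m S with f < e, F f) + F e) -
        χ (∑ f ∈ insert m S with f < e, F f)) = χ (∑ e ∈ S, F e) - χ 0 := by
      rw [← ih]
      exact Finset.sum_congr rfl fun e he => by rw [below e he]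
    rw [Finset.sum_insert hmS, below_max, lower, Finset.sum_insert hmS, add_comm (F m),
      sub_add_sub_cancel]

variable {E V : Type*} [Fintype E] (s : E → V) (r : V → E → E → Prop) (F : E → ℝ)

open Classical in
/-- If the elements `f` of each fibre of `s` are stacked as intervals of length `F f`, in the order
`r`, then this is the lower end of the interval of `e`. -/
noncomputable def stackBase (e : E) : ℝ := ∑ f with s f = s e ∧ r (s e) f e, F f

variable {s r F}

theorem stackBase_nonneg (hF : ∀ e, 0 ≤ F e) (e : E) : 0 ≤ stackBase s r F e :=
  Finset.sum_nonneg fun _ _ => hF _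

theorem stackBase_mem {A : AddSubgroup ℝ} (hF : ∀ e, F e ∈ A) (e : E) : stackBase s r F e ∈ A :=
  sum_mem fun _ _ => hF _

open Classical in
theorem stackBase_add_le_sum (hF : ∀ e, 0 ≤ F e) {e : E} (hirr : ¬ r (s e) e e) {S : Finset E}
    (he : e ∈ S) (hS : ∀ f, s f = s e → r (s e) f e → f ∈ S) :
    stackBase s r F e + F e ≤ ∑ f ∈ S, F f := by
  rw [stackBase, add_comm, ← Finset.sum_insert (by simp [hirr])]
  refine Finset.sum_le_sum_of_subset_of_nonneg (fun f hf => ?_) fun _ _ _ => hF _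
  rcases Finset.mem_insert.1 hf with rfl | hf
  · exact he
  · exact hS f (Finset.mem_filter.1 hf).2.1 (Finset.mem_filter.1 hf).2.2

theorem stackBase_add_le_sum_fiber [DecidableEq V] (hF : ∀ e, 0 ≤ F e) {v : V}
    (hr : IsStrictTotalOrder {e // s e = v} fun e f => r v e f) {e : E} (he : s e = v) :
    stackBase s r F e + F e ≤ ∑ f with s f = v, F f := by
  subst he
  exact stackBase_add_le_sum hF (hr.irrefl ⟨e, rfl⟩) (by simp) (by simp +contextual)

theorem stackBase_add_le_stackBase (hF : ∀ e, 0 ≤ F e) {v : V}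
    (hr : IsStrictTotalOrder {e // s e = v} fun e f => r v e f) {e f : E} (he : s e = v)
    (hf : s f = v) (h : r v e f) : stackBase s r F e + F e ≤ stackBase s r F f := by
  classical
  subst he
  refine stackBase_add_le_sum hF (hr.irrefl ⟨e, rfl⟩) (by simp [hf, h]) fun g hg hge => ?_
  simpa [hf, hg] using hr.trans ⟨g, hg⟩ ⟨e, rfl⟩ ⟨f, hf⟩ hge h

theorem sum_stackBase_telescope [DecidableEq V] {N : Type*} [AddCommGroup N] {v : V}
    (hr : IsStrictTotalOrder {e // s e = v} fun e f => r v e f) (χ : ℝ → N) :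
    ∑ e with s e = v, (χ (stackBase s r F e + F e) - χ (stackBase s r F e)) =
      χ (∑ e with s e = v, F e) - χ 0 := by
  classical
  let _ : LinearOrder {e // s e = v} := linearOrderOfSTO fun e f => r v e f
  have base (e : {e // s e = v}) : ∑ f : {e // s e = v} with f < e, F f = stackBase s r F e := by
    rw [stackBase, e.2, ← Finset.filter_filter, Finset.sum_filter, Finset.sum_filter,
      Finset.sum_subtype _ (p := fun f => s f = v) (by simp)]
    exact Finset.sum_congr rfl fun f _ => if_congr Iff.rfl rfl rfl
  have := sum_sub_telescope_of_linearOrder (fun e : {e // s e = v} => F e) χ Finset.univ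
  simp only [base] at this
  rwa [Finset.sum_subtype (p := fun e => s e = v) _ (by simp),
    Finset.sum_subtype (p := fun e => s e = v) _ (by simp)]

end Stack

section Overlap

/-- The length of the part of the interval `[b, b + c]` that lies below `y` (for `0 ≤ c`). -/
def overlap (b c y : ℝ) : ℝ := min y (b + c) - min y b

variable {b c y : ℝ}

theorem overlap_mono (hc : 0 ≤ c) : Monotone (overlap b c) := by
  intro y z hyz
  simp only [overlap]
  grind

theorem overlap_eq_zero (hc : 0 ≤ c) (h : y ≤ b) : overlap b c y = 0 := by
  rw [overlap, min_eq_left h, min_eq_left (by linarith), sub_self]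

theorem overlap_eq_self (hc : 0 ≤ c) (h : b + c ≤ y) : overlap b c y = c := by
  rw [overlap, min_eq_right h, min_eq_right (by linarith), add_sub_cancel_left]

theorem overlap_nonneg (hc : 0 ≤ c) : 0 ≤ overlap b c y :=
  sub_nonneg.2 (min_le_min_left _ (by linarith))

theorem overlap_le (hc : 0 ≤ c) : overlap b c y ≤ c := by
  simp only [overlap]
  grind

theorem overlap_mem {A : AddSubgroup ℝ} (hb : b ∈ A) (hc : c ∈ A) (hy : y ∈ A) :
    overlap b c y ∈ A :=
  sub_mem (min_rec' (· ∈ A) hy (add_mem hb hc)) (min_rec' (· ∈ A) hy hb)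

end Overlap

section Mass

variable {α : Type*} [Fintype α]

/-- The total weight of a set. -/
noncomputable def mass (w : α → ℝ) (A : Set α) : ℝ := ∑ p, A.indicator w p

variable {w : α → ℝ} {A B : Set α}

theorem mass_empty : mass w ∅ = 0 := by simp [mass]

theorem mass_singleton (p : α) : mass w {p} = w p := by
  classical
  simp [mass, Set.indicator_apply]

theorem mass_congr (h : ∀ p, w p ≠ 0 → (p ∈ A ↔ p ∈ B)) : mass w A = mass w B := by
  classical
  refine Finset.sum_congr rfl fun p _ => ?_
  by_cases hp : w p = 0
  · simp [Set.indicator_apply, hp]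
  · simp [Set.indicator_apply, h p hp]

theorem mass_mono (hw : ∀ p, 0 ≤ w p) (h : A ⊆ B) : mass w A ≤ mass w B :=
  Finset.sum_le_sum fun p _ => Set.indicator_le_indicator_of_subset h hw p

theorem mass_union (h : Disjoint A B) : mass w (A ∪ B) = mass w A + mass w B := by
  simp only [mass, Set.indicator_union_of_disjoint h, Finset.sum_add_distrib]

theorem mass_inter_eq_min (hw : ∀ p, 0 ≤ w p)
    (h : ∀ p q, w p ≠ 0 → w q ≠ 0 → p ∈ A → p ∉ B → q ∈ B → q ∈ A) :
    mass w (A ∩ B) = min (mass w A) (mass w B) := by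
  by_cases hp : ∃ p, w p ≠ 0 ∧ p ∈ A ∧ p ∉ B
  · obtain ⟨p, hp, hpA, hpB⟩ := hp
    have hB : mass w (A ∩ B) = mass w B :=
      mass_congr fun q hq => ⟨And.right, fun hqB => ⟨h p q hp hq hpA hpB hqB, hqB⟩⟩
    rw [hB, min_eq_right (hB ▸ mass_mono hw Set.inter_subset_left)]
  · push Not at hp
    have hA : mass w (A ∩ B) = mass w A :=
      mass_congr fun q hq => ⟨And.left, fun hqA => ⟨hqA, hp q hq hqA⟩⟩
    rw [hA, min_eq_left (hA ▸ mass_mono hw Set.inter_subset_right)]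

theorem mass_biUnion {ι : Type*} {S : Finset ι} {A : ι → Set α}
    (hA : (S : Set ι).PairwiseDisjoint A) :
    mass w (⋃ i ∈ S, A i) = ∑ i ∈ S, mass w (A i) := by
  simp only [mass, Finset.indicator_biUnion S A hA]
  exact Finset.sum_comm

end Mass

/-! ### Paths and routes -/

variable {V E : Type*} {G : DiMultigraph V E}

section Path

variable {u u' v w w' : V} {e f : E} {l l' l₁ l₂ l₁' l₂' : List E}

theorem isPath_nil_iff : G.IsPath u [] w ↔ u = w :=
  ⟨fun h => by cases h; rfl, fun h => h ▸ .nil u⟩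

theorem isPath_cons_iff : G.IsPath u (e :: l) w ↔ G.tail e = u ∧ G.IsPath (G.head e) l w :=
  ⟨fun h => by cases h with | cons e h => exact ⟨rfl, h⟩, fun ⟨h, h'⟩ => h ▸ .cons e h'⟩

theorem isPath_append_iff :
    G.IsPath u (l ++ l') w ↔ ∃ v, G.IsPath u l v ∧ G.IsPath v l' w := by
  induction l generalizing u with
  | nil => simp [isPath_nil_iff]
  | cons e l ih => simp [isPath_cons_iff, ih, and_assoc]

theorem isPath_append_cons_iff :
    G.IsPath u (l ++ e :: l') w ↔ G.IsPath u l (G.tail e) ∧ G.IsPath (G.head e) l' w := by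
  simp [isPath_append_iff, isPath_cons_iff]

theorem isPath_snoc_iff : G.IsPath u (l ++ [e]) w ↔ G.IsPath u l (G.tail e) ∧ G.head e = w := by
  rw [isPath_append_cons_iff, isPath_nil_iff]

theorem IsPath.start_unique (h : G.IsPath u l w) (h' : G.IsPath u' l w) : u = u' := by
  cases l with
  | nil => rw [isPath_nil_iff.1 h, isPath_nil_iff.1 h']
  | cons e l => rw [← (isPath_cons_iff.1 h).1, (isPath_cons_iff.1 h').1]

theorem IsPath.finish_unique (h : G.IsPath u l w) (h' : G.IsPath u l w') : w = w' := by
  rcases List.eq_nil_or_concat' l with rfl | ⟨l, e, rfl⟩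
  · rw [← isPath_nil_iff.1 h, isPath_nil_iff.1 h']
  · rw [← (isPath_snoc_iff.1 h).2, (isPath_snoc_iff.1 h').2]

theorem IsPath.exists_split (h : G.IsPath u l w) (he : e ∈ l) :
    ∃ l₁ l₂, l = l₁ ++ e :: l₂ ∧ G.IsPath u l₁ (G.tail e) ∧ G.IsPath (G.head e) l₂ w := by
  obtain ⟨l₁, l₂, rfl⟩ := List.append_of_mem he
  exact ⟨l₁, l₂, rfl, isPath_append_cons_iff.1 h⟩

theorem IsPath.transGen (h : G.IsPath u l w) (hl : l ≠ []) :
    Relation.TransGen (fun u w => ∃ e, G.tail e = u ∧ G.head e = w) u w := by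
  induction l generalizing u with
  | nil => exact absurd rfl hl
  | cons e l ih =>
    obtain ⟨rfl, h'⟩ := isPath_cons_iff.1 h
    rcases eq_or_ne l [] with rfl | hl'
    · exact .single ⟨e, rfl, isPath_nil_iff.1 h'⟩
    · exact .head ⟨e, rfl, rfl⟩ (ih h' hl')

theorem IsSource.eq_nil_of_isPath (hv : G.IsSource v) (h : G.IsPath u l v) : l = [] := by
  rcases List.eq_nil_or_concat' l with rfl | ⟨l, e, rfl⟩
  · rfl
  · exact absurd (isPath_snoc_iff.1 h).2 (hv e)

theorem IsSink.eq_nil_of_isPath (hv : G.IsSink v) (h : G.IsPath v l w) : l = [] := by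
  cases l with
  | nil => rfl
  | cons e l => exact absurd (isPath_cons_iff.1 h).1 (hv e)

theorem not_isSink_tail (e : E) : ¬ G.IsSink (G.tail e) := fun h => h e rfl

theorem not_isSource_head (e : E) : ¬ G.IsSource (G.head e) := fun h => h e rfl

namespace IsAcyclic

theorem eq_nil_of_isPath (hG : G.IsAcyclic) (h : G.IsPath v l v) : l = [] :=
  by_contra fun hl => hG v (h.transGen hl)

theorem append_inj_of_isPath (hG : G.IsAcyclic) (h : G.IsPath u l₁ v) (h' : G.IsPath u l₁' v)
    (heq : l₁ ++ l₂ = l₁' ++ l₂') : l₁ = l₁' ∧ l₂ = l₂' := by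
  rcases List.append_eq_append_iff.1 heq with ⟨c, rfl, rfl⟩ | ⟨c, rfl, rfl⟩
  · obtain ⟨v', hv', hc⟩ := isPath_append_iff.1 h'
    obtain rfl := h.finish_unique hv'
    simp [hG.eq_nil_of_isPath hc]
  · obtain ⟨v', hv', hc⟩ := isPath_append_iff.1 h
    obtain rfl := h'.finish_unique hv'
    simp [hG.eq_nil_of_isPath hc]

theorem append_cons_inj_of_isPath (hG : G.IsAcyclic) (h : G.IsPath u (l₁ ++ e :: l₂) w)
    (heq : l₁ ++ e :: l₂ = l₁' ++ e :: l₂') : l₁ = l₁' ∧ l₂ = l₂' := by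
  simpa using hG.append_inj_of_isPath (isPath_append_cons_iff.1 h).1
    (isPath_append_cons_iff.1 (heq ▸ h)).1 heq

theorem eq_of_tail_eq (hG : G.IsAcyclic) (h : G.IsPath u l w) (he : e ∈ l) (hf : f ∈ l)
    (hef : G.tail e = G.tail f) : e = f := by
  obtain ⟨l₁, l₂, rfl, h₁, -⟩ := h.exists_split he
  obtain ⟨l₁', l₂', heq, h₁', -⟩ := h.exists_split hf
  exact (List.cons.inj (hG.append_inj_of_isPath h₁ (hef ▸ h₁') heq).2).1

theorem eq_of_head_eq (hG : G.IsAcyclic) (h : G.IsPath u l w) (he : e ∈ l) (hf : f ∈ l)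
    (hef : G.head e = G.head f) : e = f := by
  obtain ⟨l₁, l₂, rfl, h₁, -⟩ := h.exists_split he
  obtain ⟨l₁', l₂', heq, h₁', -⟩ := h.exists_split hf
  have := (hG.append_inj_of_isPath (isPath_snoc_iff.2 ⟨h₁, hef⟩) (isPath_snoc_iff.2 ⟨h₁', rfl⟩)
    (by simpa using heq)).1
  simpa using (List.append_inj' this rfl).2

theorem nodup_of_isPath (hG : G.IsAcyclic) (h : G.IsPath u l w) : l.Nodup := by
  induction h with
  | nil _ => exact List.nodup_nil
  | cons e h ih =>
    refine List.nodup_cons.2 ⟨fun he => ?_, ih⟩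
    obtain ⟨l₁, l₂, rfl, h₁, -⟩ := h.exists_split he
    simpa using hG.eq_nil_of_isPath (isPath_cons_iff.2 ⟨rfl, h₁⟩)

theorem finite_setOf_isPath (hG : G.IsAcyclic) [Finite E] :
    {l : List E | ∃ u w, G.IsPath u l w}.Finite := by
  have := Fintype.ofFinite E
  refine (List.finite_length_le E (Fintype.card E)).subset ?_
  rintro l ⟨u, w, h⟩
  exact (hG.nodup_of_isPath h).length_le_card

theorem induction_forward (hG : G.IsAcyclic) [Finite V] {P : V → Prop}
    (h : ∀ v, (∀ f, G.head f = v → P (G.tail f)) → P v) (v : V) : P v := by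
  let r := Relation.TransGen fun u w => ∃ e, G.tail e = u ∧ G.head e = w
  have : IsTrans V r := ⟨fun _ _ _ => .trans⟩
  have : Std.Irrefl r := ⟨hG⟩
  exact (Finite.wellFounded_of_trans_of_irrefl r).induction v
    fun v ih => h v fun f hf => ih _ (Relation.TransGen.single ⟨f, rfl, hf⟩)

theorem induction_backward (hG : G.IsAcyclic) [Finite V] {P : V → Prop}
    (h : ∀ v, (∀ f, G.tail f = v → P (G.head f)) → P v) (v : V) : P v := by
  let r := Relation.TransGen fun u w => ∃ e, G.tail e = u ∧ G.head e = w
  have : IsTrans V (Function.swap r) := ⟨fun _ _ _ hvu hwv => hwv.trans hvu⟩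
  have : Std.Irrefl (Function.swap r) := ⟨hG⟩
  exact (Finite.wellFounded_of_trans_of_irrefl (Function.swap r)).induction v
    fun v ih => h v fun f hf => ih _ (Relation.TransGen.single ⟨f, hf, rfl⟩)

end IsAcyclic

end Path

section Route

theorem Route.eq_of_src_eq_of_edges_eq {p q : G.Route} (hsrc : p.src = q.src)
    (h : p.edges = q.edges) : p = q :=
  Route.ext hsrc h (p.isPath.finish_unique (hsrc ▸ h ▸ q.isPath))

theorem Route.eq_of_edges_eq {p q : G.Route} (hp : p.edges ≠ []) (h : p.edges = q.edges) :
    p = q := by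
  obtain ⟨e, l, hl⟩ := List.exists_cons_of_ne_nil hp
  have hp' : G.IsPath p.src (e :: l) p.snk := hl ▸ p.isPath
  have hq' : G.IsPath q.src (e :: l) q.snk := hl ▸ h ▸ q.isPath
  exact eq_of_src_eq_of_edges_eq
    ((isPath_cons_iff.1 hp').1.symm.trans (isPath_cons_iff.1 hq').1) h

theorem Route.finite [Finite V] [Finite E] (hG : G.IsAcyclic) : Finite G.Route := by
  have := hG.finite_setOf_isPath.to_subtype
  refine Finite.of_injective (β := V × {l : List E | ∃ u w, G.IsPath u l w})
    (fun p => ⟨p.src, p.edges, _, _, p.isPath⟩) fun p q h => ?_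
  simp only [Prod.mk.injEq, Subtype.mk.injEq] at h
  exact eq_of_src_eq_of_edges_eq h.1 h.2

theorem Route.edges_ne_nil (hG : ∀ v, G.IsSource v → ¬ G.IsSink v) (p : G.Route) :
    p.edges ≠ [] := fun h => by
  have hsrc : p.src = p.snk := isPath_nil_iff.1 (h ▸ p.isPath)
  exact hG _ p.isSource (hsrc ▸ p.isSink)

end Route

section SourcePaths

namespace IsAcyclic

variable [Fintype E] (hG : G.IsAcyclic) {v : V} {l : List E}

/-- The paths from the sources to `v`. -/
noncomputable def sourcePaths (v : V) : Finset (List E) :=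
  (hG.finite_setOf_isPath.subset (t := {l | ∃ u, G.IsSource u ∧ G.IsPath u l v})
    fun _ ⟨u, _, h⟩ => ⟨u, v, h⟩).toFinset

/-- The paths from `v` to the sinks. -/
noncomputable def sinkPaths (v : V) : Finset (List E) :=
  (hG.finite_setOf_isPath.subset (t := {l | ∃ w, G.IsSink w ∧ G.IsPath v l w})
    fun _ ⟨w, _, h⟩ => ⟨v, w, h⟩).toFinset

variable {hG}

theorem mem_sourcePaths : l ∈ hG.sourcePaths v ↔ ∃ u, G.IsSource u ∧ G.IsPath u l v := by
  simp [sourcePaths]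

theorem mem_sinkPaths : l ∈ hG.sinkPaths v ↔ ∃ w, G.IsSink w ∧ G.IsPath v l w := by
  simp [sinkPaths]

theorem sourcePaths_of_isSource (hv : G.IsSource v) : hG.sourcePaths v = {[]} := by
  ext l
  rw [mem_sourcePaths, Finset.mem_singleton]
  exact ⟨fun ⟨_, _, h⟩ => hv.eq_nil_of_isPath h, fun h => ⟨v, hv, h ▸ .nil v⟩⟩

theorem sinkPaths_of_isSink (hv : G.IsSink v) : hG.sinkPaths v = {[]} := by
  ext l
  rw [mem_sinkPaths, Finset.mem_singleton]
  exact ⟨fun ⟨_, _, h⟩ => hv.eq_nil_of_isPath h, fun h => ⟨v, hv, h ▸ .nil v⟩⟩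

variable {N : Type*} [AddCommMonoid N]

open Classical in
theorem sum_routes_through [Fintype G.Route] (hG : G.IsAcyclic) (e : E) (g : List E → N) :
    ∑ p : G.Route with e ∈ p.edges, g p.edges =
      ∑ l ∈ hG.sourcePaths (G.tail e), ∑ l' ∈ hG.sinkPaths (G.head e), g (l ++ e :: l') := by
  rw [← Finset.sum_product']
  symm
  have lift (x) (hx : x ∈ hG.sourcePaths (G.tail e) ×ˢ hG.sinkPaths (G.head e)) :
      ∃ p : G.Route, p.edges = x.1 ++ e :: x.2 := by
    rw [Finset.mem_product, mem_sourcePaths, mem_sinkPaths] at hx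
    obtain ⟨⟨u, hu, hl⟩, w, hw, hl'⟩ := hx
    exact ⟨⟨u, _, w, isPath_append_cons_iff.2 ⟨hl, hl'⟩, hu, hw⟩, rfl⟩
  choose r hr using lift
  refine Finset.sum_bij r (fun x hx => by simp [hr]) (fun x hx y hy h => ?_) (fun p hp => ?_)
    fun x hx => by rw [hr]
  · have heq : x.1 ++ e :: x.2 = y.1 ++ e :: y.2 := by rw [← hr x hx, ← hr y hy, h]
    exact Prod.ext_iff.2 (hG.append_cons_inj_of_isPath (hr x hx ▸ (r x hx).isPath) heq)
  · obtain ⟨l₁, l₂, heq, h₁, h₂⟩ := p.isPath.exists_split (Finset.mem_filter.1 hp).2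
    have hx : (l₁, l₂) ∈ hG.sourcePaths (G.tail e) ×ˢ hG.sinkPaths (G.head e) :=
      Finset.mk_mem_product (mem_sourcePaths.2 ⟨_, p.isSource, h₁⟩)
        (mem_sinkPaths.2 ⟨_, p.isSink, h₂⟩)
    exact ⟨_, hx, Route.eq_of_edges_eq (by simp [hr]) (by rw [hr, heq])⟩

variable [DecidableEq V]

theorem sum_sourcePaths (hv : ¬ G.IsSource v) (g : List E → N) :
    ∑ l ∈ hG.sourcePaths v, g l =
      ∑ f with G.head f = v, ∑ l ∈ hG.sourcePaths (G.tail f), g (l ++ [f]) := by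
  rw [Finset.sum_sigma']
  symm
  refine Finset.sum_bij (fun x _ => x.2 ++ [x.1]) ?_ ?_ ?_ fun _ _ => rfl
  · simp only [Finset.mem_sigma, Finset.mem_filter, Finset.mem_univ, true_and, mem_sourcePaths]
    rintro ⟨f, l⟩ ⟨hf, u, hu, hl⟩
    exact ⟨u, hu, isPath_snoc_iff.2 ⟨hl, hf⟩⟩
  · rintro ⟨f, l⟩ - ⟨f', l'⟩ - h
    obtain ⟨hl, hf⟩ := List.append_inj' h rfl
    exact Sigma.ext (List.singleton_inj.1 hf) (heq_of_eq hl)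
  · simp only [mem_sourcePaths]
    rintro l ⟨u, hu, hl⟩
    rcases List.eq_nil_or_concat' l with rfl | ⟨l, f, rfl⟩
    · exact absurd (isPath_nil_iff.1 hl ▸ hu) hv
    · obtain ⟨hl, hf⟩ := isPath_snoc_iff.1 hl
      exact ⟨⟨f, l⟩, by simpa [mem_sourcePaths, hf] using ⟨u, hu, hl⟩, rfl⟩

theorem sum_sinkPaths (hv : ¬ G.IsSink v) (g : List E → N) :
    ∑ l ∈ hG.sinkPaths v, g l =
      ∑ f with G.tail f = v, ∑ l ∈ hG.sinkPaths (G.head f), g (f :: l) := by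
  rw [Finset.sum_sigma']
  symm
  refine Finset.sum_bij (fun x _ => x.1 :: x.2) ?_ ?_ ?_ fun _ _ => rfl
  · simp only [Finset.mem_sigma, Finset.mem_filter, Finset.mem_univ, true_and, mem_sinkPaths]
    rintro ⟨f, l⟩ ⟨hf, w, hw, hl⟩
    exact ⟨w, hw, isPath_cons_iff.2 ⟨hf, hl⟩⟩
  · rintro ⟨f, l⟩ - ⟨f', l'⟩ - h
    obtain ⟨rfl, rfl⟩ := List.cons.inj h
    rfl
  · simp only [mem_sinkPaths]
    rintro l ⟨w, hw, hl⟩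
    cases l with
    | nil => exact absurd (isPath_nil_iff.1 hl ▸ hw) hv
    | cons f l =>
      obtain ⟨hf, hl⟩ := isPath_cons_iff.1 hl
      exact ⟨⟨f, l⟩, by simpa [mem_sinkPaths, hf] using ⟨w, hw, hl⟩, rfl⟩

end IsAcyclic

end SourcePaths

/-! ### The pre- and post-orders -/

namespace Framing

variable (𝓕 : G.Framing)

theorem outLt_irrefl (e : E) : ¬ 𝓕.outLt (G.tail e) e e :=
  (𝓕.outLt_total _ (not_isSink_tail e)).irrefl ⟨e, rfl⟩

theorem outLt_trans {v : V} {e f g : E} (he : G.tail e = v) (hf : G.tail f = v)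
    (hg : G.tail g = v) (h : 𝓕.outLt v e f) (h' : 𝓕.outLt v f g) : 𝓕.outLt v e g :=
  (𝓕.outLt_total v (he ▸ not_isSink_tail e)).trans ⟨e, he⟩ ⟨f, hf⟩ ⟨g, hg⟩ h h'

theorem outLt_or_outLt {v : V} {e f : E} (he : G.tail e = v) (hf : G.tail f = v) (hne : e ≠ f) :
    𝓕.outLt v e f ∨ 𝓕.outLt v f e := by
  have := 𝓕.outLt_total v (he ▸ not_isSink_tail e)
  by_contra! h
  exact hne (Subtype.ext_iff.1 (this.trichotomous ⟨e, he⟩ ⟨f, hf⟩ h.1 h.2))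

theorem inLt_irrefl {v : V} (hv : G.IsInternal v) {e : E} (he : G.head e = v) :
    ¬ 𝓕.inLt v e e :=
  (𝓕.inLt_total _ hv).irrefl ⟨e, he⟩

theorem inLt_trans {v : V} (hv : G.IsInternal v) {e f g : E} (he : G.head e = v)
    (hf : G.head f = v) (hg : G.head g = v) (h : 𝓕.inLt v e f) (h' : 𝓕.inLt v f g) :
    𝓕.inLt v e g :=
  (𝓕.inLt_total v hv).trans ⟨e, he⟩ ⟨f, hf⟩ ⟨g, hg⟩ h h'

theorem inLt_or_inLt {v : V} (hv : G.IsInternal v) {e f : E} (he : G.head e = v)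
    (hf : G.head f = v) (hne : e ≠ f) : 𝓕.inLt v e f ∨ 𝓕.inLt v f e := by
  have := 𝓕.inLt_total v hv
  by_contra! h
  exact hne (Subtype.ext_iff.1 (this.trichotomous ⟨e, he⟩ ⟨f, hf⟩ h.1 h.2))

theorem srcLt_trans {u v w : V} (hu : G.IsSource u) (hv : G.IsSource v) (hw : G.IsSource w)
    (h : 𝓕.srcLt u v) (h' : 𝓕.srcLt v w) : 𝓕.srcLt u w :=
  𝓕.srcLt_total.trans ⟨u, hu⟩ ⟨v, hv⟩ ⟨w, hw⟩ h h'

theorem srcLt_or_srcLt {u v : V} (hu : G.IsSource u) (hv : G.IsSource v) (hne : u ≠ v) :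
    𝓕.srcLt u v ∨ 𝓕.srcLt v u := by
  by_contra! h
  exact hne (Subtype.ext_iff.1 (𝓕.srcLt_total.trichotomous ⟨u, hu⟩ ⟨v, hv⟩ h.1 h.2))

theorem not_postLt_nil_left (q : List E) : ¬ 𝓕.PostLt [] q := by
  rintro ⟨σ, p', q', f, g, h, -⟩
  simp at h

theorem not_postLt_nil_right (p : List E) : ¬ 𝓕.PostLt p [] := by
  rintro ⟨σ, p', q', f, g, -, h, -⟩
  simp at h

theorem postLt_cons_iff {e f : E} {p q : List E} :
    𝓕.PostLt (e :: p) (f :: q) ↔ 𝓕.outLt (G.tail e) e f ∨ e = f ∧ 𝓕.PostLt p q := by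
  constructor
  · rintro ⟨σ, p', q', f', g', h1, h2, h3⟩
    cases σ with
    | nil =>
      simp only [List.nil_append, List.cons.injEq] at h1 h2
      exact Or.inl (by rw [h1.1, h2.1]; exact h3)
    | cons x σ =>
      simp only [List.cons_append, List.cons.injEq] at h1 h2
      exact Or.inr ⟨h1.1.trans h2.1.symm, σ, p', q', f', g', h1.2, h2.2, h3⟩
  · rintro (h | ⟨rfl, σ, p', q', f', g', h1, h2, h3⟩)
    · exact ⟨[], p, q, e, f, rfl, rfl, h⟩
    · exact ⟨e :: σ, p', q', f', g', by simp [h1], by simp [h2], h3⟩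

theorem postLt_irrefl (p : List E) : ¬ 𝓕.PostLt p p := by
  induction p with
  | nil => exact 𝓕.not_postLt_nil_left []
  | cons e p ih =>
    rw [postLt_cons_iff]
    rintro (h | h)
    · exact 𝓕.outLt_irrefl e h
    · exact ih h.2

theorem postLt_trans {v w₁ w₂ w₃ : V} {p q r : List E} (hp : G.IsPath v p w₁)
    (hq : G.IsPath v q w₂) (hr : G.IsPath v r w₃) (h : 𝓕.PostLt p q) (h' : 𝓕.PostLt q r) :
    𝓕.PostLt p r := by
  induction p generalizing v q r with
  | nil => exact absurd h (𝓕.not_postLt_nil_left _)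
  | cons e p ih =>
    rcases q with _ | ⟨f, q⟩
    · exact absurd h (𝓕.not_postLt_nil_right _)
    rcases r with _ | ⟨g, r⟩
    · exact absurd h' (𝓕.not_postLt_nil_right _)
    obtain ⟨he, hp⟩ := isPath_cons_iff.1 hp
    obtain ⟨hf, hq⟩ := isPath_cons_iff.1 hq
    obtain ⟨hg, hr⟩ := isPath_cons_iff.1 hr
    rw [postLt_cons_iff] at h h' ⊢
    rw [he] at h ⊢
    rw [hf] at h'
    rcases h with h | ⟨rfl, h⟩ <;> rcases h' with h' | ⟨rfl, h'⟩
    · exact Or.inl (𝓕.outLt_trans he hf hg h h')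
    · exact Or.inl h
    · exact Or.inl h'
    · exact Or.inr ⟨rfl, ih hp hq hr h h'⟩

theorem postLt_total {v w₁ w₂ : V} {p q : List E} (hp : G.IsPath v p w₁) (hw₁ : G.IsSink w₁)
    (hq : G.IsPath v q w₂) (hw₂ : G.IsSink w₂) (hne : p ≠ q) :
    𝓕.PostLt p q ∨ 𝓕.PostLt q p := by
  induction p generalizing v q with
  | nil =>
    cases isPath_nil_iff.1 hp
    exact absurd (hw₁.eq_nil_of_isPath hq).symm hne
  | cons e p ih =>
    cases q with
    | nil =>
      cases isPath_nil_iff.1 hq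
      exact absurd (hw₂.eq_nil_of_isPath hp) hne
    | cons f q =>
      obtain ⟨he, hp⟩ := isPath_cons_iff.1 hp
      obtain ⟨hf, hq⟩ := isPath_cons_iff.1 hq
      rw [postLt_cons_iff, postLt_cons_iff, he, hf]
      rcases eq_or_ne e f with rfl | hef
      · exact (ih hp hq (by simpa using hne)).imp
          (fun h => Or.inr ⟨rfl, h⟩) fun h => Or.inr ⟨rfl, h⟩
      · exact (𝓕.outLt_or_outLt he hf hef).imp Or.inl Or.inl

theorem not_preLt_nil_left (q : List E) : ¬ 𝓕.PreLt [] q := by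
  rintro ⟨σ, p', q', f, g, h, -⟩
  simp at h

theorem not_preLt_nil_right (p : List E) : ¬ 𝓕.PreLt p [] := by
  rintro ⟨σ, p', q', f, g, -, h, -⟩
  simp at h

theorem preLt_snoc_iff {e f : E} {p q : List E} :
    𝓕.PreLt (p ++ [e]) (q ++ [f]) ↔ 𝓕.inLt (G.head e) e f ∨ e = f ∧ 𝓕.PreLt p q := by
  constructor
  · rintro ⟨σ, p', q', f', g', h1, h2, h3⟩
    rcases List.eq_nil_or_concat' σ with rfl | ⟨σ, x, rfl⟩
    · obtain ⟨-, h1⟩ := List.append_inj' h1 rfl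
      obtain ⟨-, h2⟩ := List.append_inj' h2 rfl
      simp only [List.cons.injEq, and_true] at h1 h2
      exact Or.inl (by rw [h1, h2]; exact h3)
    · rw [← List.cons_append, ← List.append_assoc] at h1 h2
      obtain ⟨h1, h1'⟩ := List.append_inj' h1 rfl
      obtain ⟨h2, h2'⟩ := List.append_inj' h2 rfl
      simp only [List.cons.injEq, and_true] at h1' h2'
      exact Or.inr ⟨h1'.trans h2'.symm, σ, p', q', f', g', h1, h2, h3⟩
  · rintro (h | ⟨rfl, σ, p', q', f', g', h1, h2, h3⟩)
    · exact ⟨[], p, q, e, f, rfl, rfl, h⟩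
    · exact ⟨σ ++ [e], p', q', f', g', by simp [h1], by simp [h2], h3⟩

theorem preLt_irrefl {u v : V} {p : List E} (hp : G.IsPath u p v) (hv : ¬ G.IsSink v) :
    ¬ 𝓕.PreLt p p := by
  induction p using List.reverseRecOn generalizing v with
  | nil => exact 𝓕.not_preLt_nil_left []
  | append_singleton p e ih =>
    obtain ⟨hp', rfl⟩ := isPath_snoc_iff.1 hp
    rw [preLt_snoc_iff]
    rintro (h | h)
    · exact 𝓕.inLt_irrefl ⟨not_isSource_head e, hv⟩ rfl h
    · exact ih hp' (not_isSink_tail e) h.2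

theorem preLt_trans {v u₁ u₂ u₃ : V} (hv : ¬ G.IsSink v) {p q r : List E} (hp : G.IsPath u₁ p v)
    (hq : G.IsPath u₂ q v) (hr : G.IsPath u₃ r v) (h : 𝓕.PreLt p q) (h' : 𝓕.PreLt q r) :
    𝓕.PreLt p r := by
  induction p using List.reverseRecOn generalizing v q r with
  | nil => exact absurd h (𝓕.not_preLt_nil_left _)
  | append_singleton p e ih =>
    rcases List.eq_nil_or_concat' q with rfl | ⟨q, f, rfl⟩
    · exact absurd h (𝓕.not_preLt_nil_right _)
    rcases List.eq_nil_or_concat' r with rfl | ⟨r, g, rfl⟩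
    · exact absurd h' (𝓕.not_preLt_nil_right _)
    obtain ⟨hp, he⟩ := isPath_snoc_iff.1 hp
    obtain ⟨hq, hf⟩ := isPath_snoc_iff.1 hq
    obtain ⟨hr, hg⟩ := isPath_snoc_iff.1 hr
    have hv' : G.IsInternal v := ⟨he ▸ not_isSource_head e, hv⟩
    rw [preLt_snoc_iff] at h h' ⊢
    rw [he] at h ⊢
    rw [hf] at h'
    rcases h with h | ⟨rfl, h⟩ <;> rcases h' with h' | ⟨rfl, h'⟩
    · exact Or.inl (𝓕.inLt_trans hv' he hf hg h h')
    · exact Or.inl h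
    · exact Or.inl h'
    · exact Or.inr ⟨rfl, ih (not_isSink_tail e) hp hq hr h h'⟩

theorem preLt_total {v u₁ u₂ : V} (hv : ¬ G.IsSink v) {p q : List E} (hp : G.IsPath u₁ p v)
    (hu₁ : G.IsSource u₁) (hq : G.IsPath u₂ q v) (hu₂ : G.IsSource u₂) (hne : p ≠ q) :
    𝓕.PreLt p q ∨ 𝓕.PreLt q p := by
  induction p using List.reverseRecOn generalizing v q with
  | nil =>
    cases isPath_nil_iff.1 hp
    exact absurd (hu₁.eq_nil_of_isPath hq).symm hne
  | append_singleton p e ih =>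
    rcases List.eq_nil_or_concat' q with rfl | ⟨q, f, rfl⟩
    · cases isPath_nil_iff.1 hq
      exact absurd (hu₂.eq_nil_of_isPath hp) hne
    obtain ⟨hp, he⟩ := isPath_snoc_iff.1 hp
    obtain ⟨hq, hf⟩ := isPath_snoc_iff.1 hq
    have hv' : G.IsInternal v := ⟨he ▸ not_isSource_head e, hv⟩
    rw [preLt_snoc_iff, preLt_snoc_iff, he, hf]
    rcases eq_or_ne e f with rfl | hef
    · exact (ih (not_isSink_tail e) hp hq (by simpa using hne)).imp
        (fun h => Or.inr ⟨rfl, h⟩) fun h => Or.inr ⟨rfl, h⟩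
    · exact (𝓕.inLt_or_inLt hv' he hf hef).imp Or.inl Or.inl

end Framing

/-! ### The stacked decomposition of a flow -/

/-- Conservation of flow at the internal vertices. -/
def IsConserved [Fintype E] [DecidableEq V] (G : DiMultigraph V E) (F : E → ℝ) : Prop :=
  ∀ v, G.IsInternal v → ∑ e with G.tail e = v, F e = ∑ e with G.head e = v, F e

namespace Framing

variable [Fintype E] (𝓕 : G.Framing) (F : E → ℝ)

/-- The total flow on the edges that precede `e` among the incoming edges of its head. -/
noncomputable def inBase : E → ℝ := stackBase G.head 𝓕.inLt F

/-- The total flow on the edges that precede `e` among the outgoing edges of its tail. -/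
noncomputable def outBase : E → ℝ := stackBase G.tail 𝓕.outLt F

/-- The flow through the vertex between `e` and `e'` is stacked by the order of incoming edges and
by the order of outgoing edges; of the part of the stack that lies below height `t` of `e`, this is
the amount that continues by `e'`. -/
noncomputable def step (e e' : E) (t : ℝ) : ℝ :=
  overlap (𝓕.outBase F e') (F e') (𝓕.inBase F e + t)

/-- Follow a height in `e` along the path `e :: l`. -/
noncomputable def push : E → List E → ℝ → ℝ
  | _, [], t => t
  | e, e' :: l, t => push e' l (𝓕.step F e e' t)

/-- Follow the height `s` along the path `l ++ [e]`, starting from its first edge. -/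
noncomputable def height (s : E → ℝ) : List E → E → ℝ
  | [], e => s e
  | e₁ :: l, e => 𝓕.push F e₁ (l ++ [e]) (s e₁)

/-- The weight of a path in the stacked decomposition of `F`. -/
noncomputable def pathWeight : List E → ℝ
  | [] => 0
  | e :: l => 𝓕.push F e l (F e) - 𝓕.push F e l 0

variable {𝓕 F}

theorem push_append_cons (e e' : E) (l l' : List E) (t : ℝ) :
    𝓕.push F e (l ++ e' :: l') t = 𝓕.push F e' l' (𝓕.push F e (l ++ [e']) t) := by
  induction l generalizing e t with
  | nil => rfl
  | cons f _ ih => exact ih f _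

theorem height_append_cons (s : E → ℝ) (l l' : List E) (e e' : E) :
    𝓕.height F s (l ++ e :: l') e' = 𝓕.push F e (l' ++ [e']) (𝓕.height F s l e) := by
  cases l with
  | nil => rfl
  | cons e₁ l => simp [height, push_append_cons (e' := e) (l' := l' ++ [e'])]

theorem height_snoc (s : E → ℝ) (l : List E) (e e' : E) :
    𝓕.height F s (l ++ [e]) e' = 𝓕.step F e e' (𝓕.height F s l e) :=
  height_append_cons s l [] e e'

theorem pathWeight_append_cons (l l' : List E) (e : E) :
    𝓕.pathWeight F (l ++ e :: l') =
      𝓕.push F e l' (𝓕.height F F l e) - 𝓕.push F e l' (𝓕.height F 0 l e) := by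
  cases l with
  | nil => rfl
  | cons e₁ l => simp [height, pathWeight, push_append_cons (e' := e) (l' := l')]

section Integrality

variable {A : AddSubgroup ℝ}

theorem push_mem (hF : ∀ e, F e ∈ A) (e : E) (l : List E) {t : ℝ} (ht : t ∈ A) :
    𝓕.push F e l t ∈ A := by
  induction l generalizing e t with
  | nil => exact ht
  | cons f _ ih =>
    exact ih f (overlap_mem (stackBase_mem hF f) (hF f) (add_mem (stackBase_mem hF e) ht))

theorem pathWeight_mem (hF : ∀ e, F e ∈ A) (l : List E) : 𝓕.pathWeight F l ∈ A := by
  cases l with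
  | nil => exact zero_mem A
  | cons e l => exact sub_mem (push_mem hF e l (hF e)) (push_mem hF e l (zero_mem A))

theorem closure_range_pathWeight_le (hF : ∀ e, F e ∈ A) :
    AddSubgroup.closure (Set.range fun p : G.Route => 𝓕.pathWeight F p.edges) ≤ A :=
  (AddSubgroup.closure_le _).2 (Set.range_subset_iff.2 fun p => pathWeight_mem hF p.edges)

end Integrality

section Bounds

theorem step_le_step (hF : ∀ e, 0 ≤ F e) {e f c : E} {t u : ℝ}
    (h : 𝓕.inBase F e + t ≤ 𝓕.inBase F f + u) : 𝓕.step F e c t ≤ 𝓕.step F f c u :=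
  overlap_mono (hF c) h

theorem push_mono (hF : ∀ e, 0 ≤ F e) (e : E) (l : List E) : Monotone (𝓕.push F e l) := by
  induction l generalizing e with
  | nil => exact monotone_id
  | cons f _ ih => exact fun t u h => ih f (step_le_step hF (by gcongr))

theorem height_zero_le (hF : ∀ e, 0 ≤ F e) (l : List E) (e : E) :
    𝓕.height F 0 l e ≤ 𝓕.height F F l e := by
  cases l with
  | nil => exact hF e
  | cons f l => exact push_mono hF _ _ (hF f)

theorem height_zero_nonneg (hF : ∀ e, 0 ≤ F e) (l : List E) (e : E) : 0 ≤ 𝓕.height F 0 l e := by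
  rcases List.eq_nil_or_concat' l with rfl | ⟨l, f, rfl⟩
  · exact le_rfl
  · exact height_snoc (𝓕 := 𝓕) (F := F) 0 l f e ▸ overlap_nonneg (hF e)

theorem height_self_le (hF : ∀ e, 0 ≤ F e) (l : List E) (e : E) : 𝓕.height F F l e ≤ F e := by
  rcases List.eq_nil_or_concat' l with rfl | ⟨l, f, rfl⟩
  · exact le_rfl
  · exact height_snoc (𝓕 := 𝓕) (F := F) F l f e ▸ overlap_le (hF e)

theorem pathWeight_nonneg (hF : ∀ e, 0 ≤ F e) (l : List E) : 0 ≤ 𝓕.pathWeight F l := by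
  cases l with
  | nil => exact le_rfl
  | cons e l => exact sub_nonneg.2 (push_mono hF _ _ (hF e))

end Bounds

section Clique

theorem pathWeight_eq_zero_of_height_le_zero (hF : ∀ e, 0 ≤ F e) {l l' : List E} {e : E}
    (h : 𝓕.height F F l e ≤ 0) : 𝓕.pathWeight F (l ++ e :: l') = 0 := by
  have heq : 𝓕.height F F l e = 𝓕.height F 0 l e :=
    le_antisymm (h.trans (height_zero_nonneg hF l e)) (height_zero_le hF l e)
  rw [pathWeight_append_cons, heq, sub_self]

theorem pathWeight_eq_zero_of_le_height_zero (hF : ∀ e, 0 ≤ F e) {l l' : List E} {e : E}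
    (h : F e ≤ 𝓕.height F 0 l e) : 𝓕.pathWeight F (l ++ e :: l') = 0 := by
  have heq : 𝓕.height F F l e = 𝓕.height F 0 l e :=
    le_antisymm ((height_self_le hF l e).trans h) (height_zero_le hF l e)
  rw [pathWeight_append_cons, heq, sub_self]

/-- Two pieces of flow that are stacked on top of each other where they merge remain so along
their common subpath `s`. -/
theorem push_le_zero_or_le_push (hF : ∀ e, 0 ≤ F e) {f g f' g' : E} (s : List E) {t u : ℝ}
    (h : 𝓕.inBase F f + t ≤ 𝓕.inBase F g + u) (hfg : 𝓕.outBase F g' + F g' ≤ 𝓕.outBase F f') :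
    𝓕.push F f (s ++ [f']) t ≤ 0 ∨ F g' ≤ 𝓕.push F g (s ++ [g']) u := by
  induction s generalizing f g t u with
  | nil =>
    rcases le_total (𝓕.inBase F f + t) (𝓕.outBase F f') with hf | hf
    · exact Or.inl (overlap_eq_zero (hF f') hf).le
    · exact Or.inr (overlap_eq_self (hF g') (hfg.trans (hf.trans h))).ge
  | cons c _ ih => exact ih (add_le_add_right (step_le_step hF h) _)

theorem pathWeight_eq_zero_of_crossAt (hF : ∀ e, 0 ≤ F e) {i : V} {p q : G.Route}
    (h : 𝓕.CrossAt i p q) : 𝓕.pathWeight F p.edges = 0 ∨ 𝓕.pathWeight F q.edges = 0 := by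
  obtain ⟨_, _, _, _, hp, hp₁, hp₂, hq, hq₁, hq₂, ⟨σ, p₁, q₁, f, g, rfl, rfl, hin⟩,
    ⟨ρ, q₂, p₂, g', f', rfl, rfl, hout⟩⟩ := h
  have hfσ := (isPath_append_cons_iff.1 hp₁).2
  have hgσ := (isPath_append_cons_iff.1 hq₁).2
  have hρf := (isPath_append_cons_iff.1 hp₂).1
  have hρg := (isPath_append_cons_iff.1 hq₂).1
  have head_eq : G.head f = G.head g := hfσ.start_unique hgσ
  have tail_eq : G.tail g' = G.tail f' := hρg.finish_unique hρf
  have internal : G.IsInternal (G.head f) := by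
    refine ⟨not_isSource_head f, fun hs => not_isSink_tail (G := G) f' ?_⟩
    have hpath := isPath_append_iff.2 ⟨i, hfσ, hρf⟩
    exact isPath_nil_iff.1 (hs.eq_nil_of_isPath hpath ▸ hpath) ▸ hs
  have separated : 𝓕.inBase F f + 𝓕.height F F p₁ f ≤ 𝓕.inBase F g + 𝓕.height F 0 q₁ g := by
    calc 𝓕.inBase F f + 𝓕.height F F p₁ f
        ≤ 𝓕.inBase F f + F f := by gcongr; exact height_self_le hF p₁ f
      _ ≤ 𝓕.inBase F g :=
        stackBase_add_le_stackBase hF (𝓕.inLt_total _ internal) rfl head_eq.symm hin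
      _ ≤ 𝓕.inBase F g + 𝓕.height F 0 q₁ g := by simpa using height_zero_nonneg hF q₁ g
  have below : 𝓕.outBase F g' + F g' ≤ 𝓕.outBase F f' :=
    stackBase_add_le_stackBase hF (𝓕.outLt_total _ (not_isSink_tail g')) rfl tail_eq.symm hout
  have hp' : p.edges = (p₁ ++ f :: (σ ++ ρ)) ++ f' :: p₂ := by simp [hp]
  have hq' : q.edges = (q₁ ++ g :: (σ ++ ρ)) ++ g' :: q₂ := by simp [hq]
  rw [hp', hq']
  refine (push_le_zero_or_le_push hF (σ ++ ρ) separated below).imp (fun h => ?_) fun h => ?_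
  · exact pathWeight_eq_zero_of_height_le_zero hF (by rwa [height_append_cons])
  · exact pathWeight_eq_zero_of_le_height_zero hF (by rwa [height_append_cons])

theorem isRouteClique_support_pathWeight (hF : ∀ e, 0 ≤ F e) :
    𝓕.IsRouteClique {p : G.Route | 𝓕.pathWeight F p.edges ≠ 0} := fun _ hp _ hq _ _ =>
  ⟨fun h => (pathWeight_eq_zero_of_crossAt hF h).elim hp hq,
    fun h => (pathWeight_eq_zero_of_crossAt hF h).elim hq hp⟩

end Clique

section Sum

variable [DecidableEq V]

theorem outBase_add_le (hF : ∀ e, 0 ≤ F e) (e : E) :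
    𝓕.outBase F e + F e ≤ ∑ f with G.tail f = G.tail e, F f :=
  stackBase_add_le_sum_fiber hF (𝓕.outLt_total _ (not_isSink_tail e)) rfl

theorem inBase_add_le (hF : ∀ e, 0 ≤ F e) {e : E} (he : G.IsInternal (G.head e)) :
    𝓕.inBase F e + F e ≤ ∑ f with G.head f = G.head e, F f :=
  stackBase_add_le_sum_fiber hF (𝓕.inLt_total _ he) rfl

theorem sum_step (hF : ∀ e, 0 ≤ F e) (hcons : G.IsConserved F) {e : E}
    (he : ¬ G.IsSink (G.head e)) {t : ℝ} (ht0 : 0 ≤ t) (ht : t ≤ F e) :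
    ∑ f with G.tail f = G.head e, 𝓕.step F e f t = 𝓕.inBase F e + t := by
  have internal : G.IsInternal (G.head e) := ⟨not_isSource_head e, he⟩
  have hle : 𝓕.inBase F e + t ≤ ∑ f with G.tail f = G.head e, F f := by
    rw [hcons _ internal]
    exact (add_le_add_right ht _).trans (inBase_add_le hF internal)
  have hnonneg : 0 ≤ 𝓕.inBase F e + t := add_nonneg (stackBase_nonneg hF e) ht0
  calc ∑ f with G.tail f = G.head e, 𝓕.step F e f t
      = min (𝓕.inBase F e + t) (∑ f with G.tail f = G.head e, F f) -
          min (𝓕.inBase F e + t) 0 :=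
        sum_stackBase_telescope (𝓕.outLt_total _ he) fun y => min (𝓕.inBase F e + t) y
    _ = 𝓕.inBase F e + t := by rw [min_eq_left hle, min_eq_right hnonneg, sub_zero]

variable [Finite V]

/-- The paths from the sources to `e` tile the interval `[0, F e]`; this is stated for an arbitrary
function `ψ` of the end points so that the induction goes through. -/
theorem sum_sourcePaths_height (hG : G.IsAcyclic) (hF : ∀ e, 0 ≤ F e) (hcons : G.IsConserved F)
    (e : E) (ψ : ℝ → ℝ) :
    ∑ l ∈ hG.sourcePaths (G.tail e), (ψ (𝓕.height F F l e) - ψ (𝓕.height F 0 l e)) =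
      ψ (F e) - ψ 0 := by
  obtain ⟨v, hv⟩ : ∃ v, G.tail e = v := ⟨_, rfl⟩
  rw [hv]
  induction v using hG.induction_forward generalizing e ψ with
  | h v ih =>
    by_cases hs : G.IsSource v
    · simp [IsAcyclic.sourcePaths_of_isSource hs, height]
    have internal : G.IsInternal v := ⟨hs, hv ▸ not_isSink_tail e⟩
    let χ (y : ℝ) : ℝ := ψ (overlap (𝓕.outBase F e) (F e) y)
    have per_edge (f : E) (hf : G.head f = v) : ∑ l ∈ hG.sourcePaths (G.tail f),
        (ψ (𝓕.height F F (l ++ [f]) e) - ψ (𝓕.height F 0 (l ++ [f]) e)) =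
          χ (𝓕.inBase F f + F f) - χ (𝓕.inBase F f) := by
      simpa [height_snoc, step, χ] using ih f hf f (fun t => χ (𝓕.inBase F f + t)) rfl
    have full : overlap (𝓕.outBase F e) (F e) (∑ f with G.tail f = v, F f) = F e :=
      overlap_eq_self (hF e) (hv ▸ outBase_add_le hF e)
    have none : overlap (𝓕.outBase F e) (F e) 0 = 0 :=
      overlap_eq_zero (hF e) (stackBase_nonneg hF e)
    calc ∑ l ∈ hG.sourcePaths v, (ψ (𝓕.height F F l e) - ψ (𝓕.height F 0 l e))
        = ∑ f with G.head f = v, (χ (𝓕.inBase F f + F f) - χ (𝓕.inBase F f)) := by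
          rw [IsAcyclic.sum_sourcePaths hs]
          exact Finset.sum_congr rfl fun f hf => per_edge f (Finset.mem_filter.1 hf).2
      _ = χ (∑ f with G.tail f = v, F f) - χ 0 := by
          rw [hcons v internal]
          exact sum_stackBase_telescope (𝓕.inLt_total v internal) χ
      _ = ψ (F e) - ψ 0 := by simp only [χ, full, none]

theorem sum_sinkPaths_push_sub (hG : G.IsAcyclic) (hF : ∀ e, 0 ≤ F e) (hcons : G.IsConserved F)
    (e : E) {t u : ℝ} (ht0 : 0 ≤ t) (ht : t ≤ F e) (hu0 : 0 ≤ u) (hu : u ≤ F e) :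
    ∑ l ∈ hG.sinkPaths (G.head e), (𝓕.push F e l t - 𝓕.push F e l u) = t - u := by
  obtain ⟨v, hv⟩ : ∃ v, G.head e = v := ⟨_, rfl⟩
  rw [hv]
  induction v using hG.induction_backward generalizing e t u with
  | h v ih =>
    by_cases hs : G.IsSink v
    · simp [IsAcyclic.sinkPaths_of_isSink hs, push]
    have per_edge (f : E) (hf : G.tail f = v) :
        ∑ l ∈ hG.sinkPaths (G.head f), (𝓕.push F e (f :: l) t - 𝓕.push F e (f :: l) u) =
          𝓕.step F e f t - 𝓕.step F e f u :=
      ih f hf f (overlap_nonneg (hF f)) (overlap_le (hF f)) (overlap_nonneg (hF f))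
        (overlap_le (hF f)) rfl
    subst hv
    rw [IsAcyclic.sum_sinkPaths hs,
      Finset.sum_congr rfl fun f hf => per_edge f (Finset.mem_filter.1 hf).2,
      Finset.sum_sub_distrib, sum_step hF hcons hs ht0 ht, sum_step hF hcons hs hu0 hu,
      add_sub_add_left_eq_sub]

theorem sum_pathWeight_smul_indicator [Fintype G.Route] (hG : G.IsAcyclic) (hF : ∀ e, 0 ≤ F e)
    (hcons : G.IsConserved F) : ∑ p : G.Route, 𝓕.pathWeight F p.edges • p.indicator = F := by
  classical
  funext e
  have continuations (l : List E) : ∑ l' ∈ hG.sinkPaths (G.head e),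
      𝓕.pathWeight F (l ++ e :: l') = 𝓕.height F F l e - 𝓕.height F 0 l e := by
    have hlow := height_zero_nonneg (𝓕 := 𝓕) hF l e
    have hmid := height_zero_le (𝓕 := 𝓕) hF l e
    have hhigh := height_self_le (𝓕 := 𝓕) hF l e
    simp only [pathWeight_append_cons]
    exact sum_sinkPaths_push_sub hG hF hcons e (hlow.trans hmid) hhigh hlow (hmid.trans hhigh)
  calc (∑ p : G.Route, 𝓕.pathWeight F p.edges • p.indicator) e
      = ∑ p : G.Route with e ∈ p.edges, 𝓕.pathWeight F p.edges := by
        simp [Finset.sum_apply, Route.indicator, Finset.sum_filter]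
    _ = ∑ l ∈ hG.sourcePaths (G.tail e), (𝓕.height F F l e - 𝓕.height F 0 l e) := by
        rw [IsAcyclic.sum_routes_through hG e]
        exact Finset.sum_congr rfl fun l _ => continuations l
    _ = F e := by simpa using sum_sourcePaths_height (𝓕 := 𝓕) hG hF hcons e id

end Sum

end Framing

/-! ### Clique decompositions -/

/-- The routes through `e` whose part before `e` satisfies `Q`. -/
def routesThrough (Q : List E → Prop) (e : E) : Set G.Route :=
  {p | ∃ l₁ l₂, p.edges = l₁ ++ e :: l₂ ∧ Q l₁}

/-- The routes through `v` whose part before `v` satisfies `Q`. -/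
def routesVia (Q : List E → Prop) (v : V) : Set G.Route :=
  {p | ∃ l₁ l₂, p.edges = l₁ ++ l₂ ∧ G.IsPath p.src l₁ v ∧ G.IsPath v l₂ p.snk ∧ Q l₁}

/-- The routes that use an edge of `S`. -/
def routesMeeting (S : Set E) : Set G.Route := {p | ∃ f ∈ S, f ∈ p.edges}

theorem routesMeeting_insert (e : E) (S : Set E) :
    routesMeeting (insert e S) = {p : G.Route | e ∈ p.edges} ∪ routesMeeting S := by
  ext p
  simp [routesMeeting]

theorem IsAcyclic.routesVia_inter_eq_routesThrough (hG : G.IsAcyclic) (Q : List E → Prop) (e : E) :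
    routesVia Q (G.tail e) ∩ {p : G.Route | e ∈ p.edges} = routesThrough Q e := by
  ext p
  constructor
  · rintro ⟨⟨l₁, l₂, hp, hl₁, -, hQ⟩, he⟩
    obtain ⟨m₁, m₂, hp', hm₁, -⟩ := p.isPath.exists_split he
    obtain ⟨rfl, -⟩ := hG.append_inj_of_isPath hl₁ hm₁ (hp.symm.trans hp')
    exact ⟨l₁, m₂, hp', hQ⟩
  · rintro ⟨l₁, l₂, hp, hQ⟩
    obtain ⟨hl₁, hl₂⟩ := isPath_append_cons_iff.1 (hp ▸ p.isPath)
    exact ⟨⟨l₁, e :: l₂, hp, hl₁, isPath_cons_iff.2 ⟨rfl, hl₂⟩, hQ⟩, by simp [hp]⟩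

namespace Framing

variable {𝓕 : G.Framing}

theorem routesVia_head_eq_union {Q Q' : List E → Prop} {e : E}
    (hQ : ∀ l f, G.head f = G.head e →
      (Q' (l ++ [f]) ↔ 𝓕.inLt (G.head e) f e ∨ f = e ∧ Q l)) :
    routesVia Q' (G.head e) =
      routesMeeting {f | G.head f = G.head e ∧ 𝓕.inLt (G.head e) f e} ∪
        (routesThrough Q e : Set G.Route) := by
  ext p
  constructor
  · rintro ⟨l₁, l₂, hp, hl₁, -, hQ'⟩
    rcases List.eq_nil_or_concat' l₁ with rfl | ⟨l, f, rfl⟩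
    · exact absurd (isPath_nil_iff.1 hl₁ ▸ p.isSource) (not_isSource_head e)
    have hf := (isPath_snoc_iff.1 hl₁).2
    rcases (hQ l f hf).1 hQ' with hlt | ⟨rfl, hQl⟩
    · exact Or.inl ⟨f, ⟨hf, hlt⟩, by simp [hp]⟩
    · exact Or.inr ⟨l, l₂, by simp [hp], hQl⟩
  · suffices ∀ l f l₂, p.edges = l ++ f :: l₂ → G.head f = G.head e → Q' (l ++ [f]) →
        p ∈ routesVia Q' (G.head e) by
      rintro (⟨f, ⟨hf, hlt⟩, hfp⟩ | ⟨l, l₂, hp, hQl⟩)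
      · obtain ⟨l, l₂, hp⟩ := List.append_of_mem hfp
        exact this l f l₂ hp hf ((hQ l f hf).2 (Or.inl hlt))
      · exact this l e l₂ hp rfl ((hQ l e rfl).2 (Or.inr ⟨rfl, hQl⟩))
    intro l f l₂ hp hf hQ'
    obtain ⟨hl, hl₂⟩ := isPath_append_cons_iff.1 (hp ▸ p.isPath)
    exact ⟨l ++ [f], l₂, by simp [hp], isPath_snoc_iff.2 ⟨hl, hf⟩, hf ▸ hl₂, hQ'⟩

/-- The paths from sources to `v` that satisfy `Q` precede those that do not. -/
def IsPreLower (𝓕 : G.Framing) (v : V) (Q : List E → Prop) : Prop :=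
  ∀ u₁ u₂ l₁ l₂, G.IsSource u₁ → G.IsSource u₂ → G.IsPath u₁ l₁ v → G.IsPath u₂ l₂ v →
    Q l₁ → ¬ Q l₂ → 𝓕.PreLt l₁ l₂

/-- `S` is an initial segment of the outgoing edges of `v`. -/
def IsOutLower (𝓕 : G.Framing) (v : V) (S : Set E) : Prop :=
  ∀ g ∈ S, G.tail g = v ∧ ∀ f ∉ S, G.tail f = v → 𝓕.outLt v g f

section Lower

variable {u v : V} {σ : List E}

theorem isPreLower_preLt (hv : ¬ G.IsSink v) (hu : G.IsSource u) (hσ : G.IsPath u σ v) :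
    𝓕.IsPreLower v fun l => 𝓕.PreLt l σ := by
  intro _ u₂ l₁ l₂ _ hu₂ hl₁ hl₂ hlt hnlt
  rcases eq_or_ne l₂ σ with rfl | hne
  · exact hlt
  · exact 𝓕.preLt_trans hv hl₁ hσ hl₂ hlt
      ((𝓕.preLt_total hv hl₂ hu₂ hσ hu hne).resolve_left hnlt)

theorem isPreLower_eq_or_preLt (hv : ¬ G.IsSink v) (hu : G.IsSource u) (hσ : G.IsPath u σ v) :
    𝓕.IsPreLower v fun l => l = σ ∨ 𝓕.PreLt l σ := by
  intro _ u₂ l₁ l₂ _ hu₂ hl₁ hl₂ hle hnle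
  obtain ⟨hne, hnlt⟩ := not_or.1 hnle
  have hlt := (𝓕.preLt_total hv hl₂ hu₂ hσ hu hne).resolve_left hnlt
  rcases hle with rfl | hle
  · exact hlt
  · exact 𝓕.preLt_trans hv hl₁ hσ hl₂ hle hlt

theorem isOutLower_outLt (e : E) :
    𝓕.IsOutLower (G.tail e) {f | G.tail f = G.tail e ∧ 𝓕.outLt (G.tail e) f e} := by
  rintro g ⟨hg, hge⟩
  refine ⟨hg, fun f hfS hf => ?_⟩
  rcases eq_or_ne f e with rfl | hne
  · exact hge
  · exact 𝓕.outLt_trans hg rfl hf hge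
      ((𝓕.outLt_or_outLt hf rfl hne).resolve_left fun h => hfS ⟨hf, h⟩)

theorem isOutLower_insert_outLt (e : E) :
    𝓕.IsOutLower (G.tail e) (insert e {f | G.tail f = G.tail e ∧ 𝓕.outLt (G.tail e) f e}) := by
  rintro g hg
  have hgv : G.tail g = G.tail e := hg.elim (congrArg G.tail) And.left
  refine ⟨hgv, fun f hfS hf => ?_⟩
  have hlt : 𝓕.outLt (G.tail e) e f :=
    (𝓕.outLt_or_outLt rfl hf fun h => hfS (Or.inl h.symm)).resolve_right
      fun h => hfS (Or.inr ⟨hf, h⟩)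
  rcases hg with rfl | ⟨-, hge⟩
  · exact hlt
  · exact 𝓕.outLt_trans hgv rfl hf hge hlt

end Lower

theorem IsRouteClique.mem_routesVia {R : Set G.Route} (hR : 𝓕.IsRouteClique R) {v : V}
    {Q : List E → Prop} {S : Set E} (hQ : 𝓕.IsPreLower v Q) (hS : 𝓕.IsOutLower v S)
    {p q : G.Route} (hp : p ∈ R) (hq : q ∈ R) (hpQ : p ∈ routesVia Q v)
    (hpS : p ∉ routesMeeting S) (hqS : q ∈ routesMeeting S) : q ∈ routesVia Q v := by
  by_contra hqQ
  have hpq : p ≠ q := fun h => hqQ (h ▸ hpQ)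
  obtain ⟨l₁, l₂, hpe, hl₁, hl₂, hQl⟩ := hpQ
  obtain ⟨g, hgS, hgq⟩ := hqS
  obtain ⟨rfl, hlt⟩ := hS g hgS
  obtain ⟨m₁, m₂, hqe, hm₁, hm₂⟩ := q.isPath.exists_split hgq
  have hgm₂ : G.IsPath (G.tail g) (g :: m₂) q.snk := isPath_cons_iff.2 ⟨rfl, hm₂⟩
  have hpre : 𝓕.PreLt l₁ m₁ := hQ _ _ _ _ p.isSource q.isSource hl₁ hm₁ hQl
    fun h => hqQ ⟨m₁, g :: m₂, hqe, hm₁, hgm₂, h⟩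
  have hpost : 𝓕.PostLt (g :: m₂) l₂ := by
    rcases l₂ with _ | ⟨f, l₂⟩
    · exact absurd (isPath_nil_iff.1 hl₂ ▸ p.isSink) (not_isSink_tail g)
    · exact 𝓕.postLt_cons_iff.2 (Or.inl (hlt f (fun hfS => hpS ⟨f, hfS, by simp [hpe]⟩)
        (isPath_cons_iff.1 hl₂).1))
  exact (hR hp hq hpq _).1 ⟨l₁, l₂, m₁, g :: m₂, hpe, hl₁, hl₂, hqe, hm₁, hgm₂, hpre, hpost⟩

/-- `w` expresses `F` as a nonnegative combination of the routes of a route-clique. -/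
structure IsCliqueDecomposition [Fintype G.Route] (𝓕 : G.Framing) (F : E → ℝ)
    (w : G.Route → ℝ) : Prop where
  nonneg : ∀ p, 0 ≤ w p
  clique : 𝓕.IsRouteClique {p | w p ≠ 0}
  eq_sum : ∑ p, w p • p.indicator = F

theorem isCliqueDecomposition_pathWeight [Finite V] [Fintype E] [DecidableEq V] [Fintype G.Route]
    {F : E → ℝ} (hG : G.IsAcyclic) (hF : ∀ e, 0 ≤ F e) (hcons : G.IsConserved F) :
    𝓕.IsCliqueDecomposition F fun p => 𝓕.pathWeight F p.edges where
  nonneg _ := pathWeight_nonneg hF _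
  clique := isRouteClique_support_pathWeight hF
  eq_sum := sum_pathWeight_smul_indicator hG hF hcons

namespace IsCliqueDecomposition

variable [Fintype G.Route] {F : E → ℝ} {w : G.Route → ℝ}

theorem mass_mem_edges (h : 𝓕.IsCliqueDecomposition F w) (e : E) :
    mass w {p | e ∈ p.edges} = F e := by
  classical
  simp [mass, ← h.eq_sum, Finset.sum_apply, Route.indicator, Set.indicator_apply]

theorem mass_routesMeeting (h : 𝓕.IsCliqueDecomposition F w) (S : Finset E)
    (hS : ∀ p : G.Route, ∀ e ∈ S, ∀ f ∈ S, e ∈ p.edges → f ∈ p.edges → e = f) :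
    mass w (routesMeeting (S : Set E)) = ∑ e ∈ S, F e := by
  have hunion : routesMeeting (S : Set E) = ⋃ e ∈ S, {p : G.Route | e ∈ p.edges} := by
    ext p
    simp [routesMeeting]
  rw [hunion, mass_biUnion]
  · exact Finset.sum_congr rfl fun e _ => h.mass_mem_edges e
  · exact fun e he f hf hne => Set.disjoint_left.2 fun p hep hfp => hne (hS p e he f hf hep hfp)

variable [Fintype E]

theorem mass_routesMeeting_inLt (h : 𝓕.IsCliqueDecomposition F w) (hG : G.IsAcyclic) (e : E) :
    mass w (routesMeeting {f | G.head f = G.head e ∧ 𝓕.inLt (G.head e) f e}) =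
      𝓕.inBase F e := by
  classical
  rw [inBase, stackBase, ← h.mass_routesMeeting]
  · simp
  · intro p f hf g hg hfp hgp
    simp only [Finset.mem_filter, Finset.mem_univ, true_and] at hf hg
    exact hG.eq_of_head_eq p.isPath hfp hgp (hf.1.trans hg.1.symm)

theorem mass_routesMeeting_outLt (h : 𝓕.IsCliqueDecomposition F w) (hG : G.IsAcyclic) (e : E) :
    mass w (routesMeeting {f | G.tail f = G.tail e ∧ 𝓕.outLt (G.tail e) f e}) =
      𝓕.outBase F e := by
  classical
  rw [outBase, stackBase, ← h.mass_routesMeeting]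
  · simp
  · intro p f hf g hg hfp hgp
    simp only [Finset.mem_filter, Finset.mem_univ, true_and] at hf hg
    exact hG.eq_of_tail_eq p.isPath hfp hgp (hf.1.trans hg.1.symm)

theorem mass_routesVia_head (h : 𝓕.IsCliqueDecomposition F w) (hG : G.IsAcyclic) {e : E}
    (he : ¬ G.IsSink (G.head e)) {Q Q' : List E → Prop}
    (hQ : ∀ l f, G.head f = G.head e →
      (Q' (l ++ [f]) ↔ 𝓕.inLt (G.head e) f e ∨ f = e ∧ Q l)) :
    mass w (routesVia Q' (G.head e)) = 𝓕.inBase F e + mass w (routesThrough Q e) := by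
  rw [routesVia_head_eq_union hQ, mass_union, h.mass_routesMeeting_inLt hG]
  refine Set.disjoint_left.2 ?_
  rintro p ⟨f, ⟨hf, hlt⟩, hfp⟩ ⟨l₁, l₂, hp, -⟩
  obtain rfl := hG.eq_of_head_eq p.isPath hfp (by simp [hp] : e ∈ p.edges) hf
  exact 𝓕.inLt_irrefl ⟨not_isSource_head f, he⟩ rfl hlt

theorem mass_routesThrough (h : 𝓕.IsCliqueDecomposition F w) (hG : G.IsAcyclic) {e : E}
    {Q : List E → Prop} (hQ : 𝓕.IsPreLower (G.tail e) Q) :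
    mass w (routesThrough Q e) =
      overlap (𝓕.outBase F e) (F e) (mass w (routesVia Q (G.tail e))) := by
  let A : Set G.Route := routesVia Q (G.tail e)
  let S : Set E := {f | G.tail f = G.tail e ∧ 𝓕.outLt (G.tail e) f e}
  have hdisj : Disjoint {p : G.Route | e ∈ p.edges} (routesMeeting S) := by
    refine Set.disjoint_left.2 ?_
    rintro p hep ⟨f, ⟨hf, hlt⟩, hfp⟩
    obtain rfl := hG.eq_of_tail_eq p.isPath hfp hep hf
    exact 𝓕.outLt_irrefl f hlt
  have hmassS : mass w (routesMeeting S) = 𝓕.outBase F e := h.mass_routesMeeting_outLt hG e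
  have hmass_insert : mass w (routesMeeting (insert e S)) = 𝓕.outBase F e + F e := by
    rw [routesMeeting_insert, mass_union hdisj, hmassS, h.mass_mem_edges, add_comm]
  have nested {T : Set E} (hT : 𝓕.IsOutLower (G.tail e) T) :
      mass w (A ∩ routesMeeting T) = min (mass w A) (mass w (routesMeeting T)) :=
    mass_inter_eq_min h.nonneg fun _ _ hp hq => h.clique.mem_routesVia hQ hT hp hq
  have hsplit : mass w (A ∩ routesMeeting (insert e S)) =
      mass w (routesThrough Q e) + mass w (A ∩ routesMeeting S) := by
    rw [routesMeeting_insert, Set.inter_union_distrib_left,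
      mass_union (hdisj.mono Set.inter_subset_right Set.inter_subset_right),
      hG.routesVia_inter_eq_routesThrough]
  rw [overlap, ← hmass_insert, ← nested (isOutLower_insert_outLt e), hsplit, ← hmassS,
    ← nested (isOutLower_outLt e), add_sub_cancel_right]

theorem mass_routesThrough_snoc (h : 𝓕.IsCliqueDecomposition F w) (hG : G.IsAcyclic) {e e' : E}
    (hv : G.head e = G.tail e') {Q Q' : List E → Prop} (hQ' : 𝓕.IsPreLower (G.tail e') Q')
    (hQ : ∀ l f, G.head f = G.head e →
      (Q' (l ++ [f]) ↔ 𝓕.inLt (G.head e) f e ∨ f = e ∧ Q l)) :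
    mass w (routesThrough Q' e') = 𝓕.step F e e' (mass w (routesThrough Q e)) := by
  rw [h.mass_routesThrough hG hQ', ← hv,
    h.mass_routesVia_head hG (hv ▸ not_isSink_tail e') hQ, step]

variable {u : V} {σ : List E} {e : E}

theorem mass_routesThrough_preLt (h : 𝓕.IsCliqueDecomposition F w) (hG : G.IsAcyclic)
    (hu : G.IsSource u) (hσ : G.IsPath u σ (G.tail e)) :
    mass w (routesThrough (fun l => 𝓕.PreLt l σ) e) = 𝓕.height F 0 σ e := by
  induction σ using List.reverseRecOn generalizing e with
  | nil =>
    have : routesThrough (G := G) (fun l => 𝓕.PreLt l []) e = ∅ := by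
      ext p
      simp [routesThrough, 𝓕.not_preLt_nil_right]
    rw [this, mass_empty]
    rfl
  | append_singleton σ f ih =>
    obtain ⟨hσ', hf⟩ := isPath_snoc_iff.1 hσ
    rw [height_snoc, ← ih hσ']
    exact h.mass_routesThrough_snoc hG hf (isPreLower_preLt (not_isSink_tail e) hu hσ)
      fun l g hg => by rw [preLt_snoc_iff, hg]

theorem mass_routesThrough_eq_or_preLt (h : 𝓕.IsCliqueDecomposition F w) (hG : G.IsAcyclic)
    (hu : G.IsSource u) (hσ : G.IsPath u σ (G.tail e)) :
    mass w (routesThrough (fun l => l = σ ∨ 𝓕.PreLt l σ) e) = 𝓕.height F F σ e := by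
  induction σ using List.reverseRecOn generalizing e with
  | nil =>
    have hs : G.IsSource (G.tail e) := isPath_nil_iff.1 hσ ▸ hu
    rw [height, ← h.mass_mem_edges e]
    congr 1
    ext p
    constructor
    · rintro ⟨l₁, l₂, hp, -⟩
      simp [hp]
    · intro hp
      obtain ⟨l₁, l₂, hp, hl₁, -⟩ := p.isPath.exists_split hp
      exact ⟨l₁, l₂, hp, Or.inl (hs.eq_nil_of_isPath hl₁)⟩
  | append_singleton σ f ih =>
    obtain ⟨hσ', hf⟩ := isPath_snoc_iff.1 hσ
    rw [height_snoc, ← ih hσ']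
    refine h.mass_routesThrough_snoc hG hf (isPreLower_eq_or_preLt (not_isSink_tail e) hu hσ)
      fun l g hg => ?_
    have hsnoc : l ++ [g] = σ ++ [f] ↔ l = σ ∧ g = f :=
      ⟨fun h => by simpa using List.append_inj' h rfl, by rintro ⟨rfl, rfl⟩; rfl⟩
    rw [preLt_snoc_iff, hg, hsnoc]
    tauto

theorem eq_pathWeight (h : 𝓕.IsCliqueDecomposition F w) (hG : G.IsAcyclic) {p : G.Route}
    (hp : p.edges ≠ []) : w p = 𝓕.pathWeight F p.edges := by
  obtain ⟨σ, e, hpe⟩ := (List.eq_nil_or_concat' p.edges).resolve_left hp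
  obtain ⟨hσ, he⟩ := isPath_snoc_iff.1 (hpe ▸ p.isPath)
  have hunion : routesThrough (fun l => l = σ ∨ 𝓕.PreLt l σ) e =
      {p} ∪ routesThrough (G := G) (fun l => 𝓕.PreLt l σ) e := by
    ext q
    constructor
    · rintro ⟨l₁, l₂, hq, rfl | hlt⟩
      · have hl₂ := (isPath_append_cons_iff.1 (hq ▸ q.isPath)).2
        obtain rfl := IsSink.eq_nil_of_isPath (he ▸ p.isSink) hl₂
        exact Or.inl (Route.eq_of_edges_eq hp (hpe.trans hq.symm)).symm
      · exact Or.inr ⟨l₁, l₂, hq, hlt⟩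
    · rintro (rfl | ⟨l₁, l₂, hq, hlt⟩)
      · exact ⟨σ, [], hpe, Or.inl rfl⟩
      · exact ⟨l₁, l₂, hq, Or.inr hlt⟩
  have hdisj : Disjoint {p} (routesThrough (G := G) (fun l => 𝓕.PreLt l σ) e) := by
    rw [Set.disjoint_singleton_left]
    rintro ⟨l₁, l₂, hq, hlt⟩
    obtain ⟨rfl, -⟩ := hG.append_cons_inj_of_isPath (hpe ▸ p.isPath) (hpe.symm.trans hq)
    exact 𝓕.preLt_irrefl hσ (not_isSink_tail e) hlt
  rw [hpe, pathWeight_append_cons, push, push, ← h.mass_routesThrough_preLt hG p.isSource hσ,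
    ← h.mass_routesThrough_eq_or_preLt hG p.isSource hσ, hunion, mass_union hdisj,
    mass_singleton, add_sub_cancel_right]

end IsCliqueDecomposition

end Framing

/-! ### Layerings -/

section Transversal

variable {α I J : Type*} [Fintype α] {w : α → ℝ} {s : α → I} {t : α → J} {n : J → ℕ} {x : ℝ}

theorem mass_setOf_mem (g : α → I) (S : Finset I) :
    mass w {p | g p ∈ S} = ∑ i ∈ S, mass w {p | g p = i} := by
  have hunion : {p | g p ∈ S} = ⋃ i ∈ S, {p | g p = i} := by
    ext p
    simp
  rw [hunion, mass_biUnion]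
  exact fun i _ j _ hij => Set.disjoint_left.2 fun p hi hj => hij (hi.symm.trans hj)

theorem mass_sub_indicator (L : Finset α) (c : ℝ) (A : Set α) [DecidablePred (· ∈ A)] :
    mass (w - (L : Set α).indicator fun _ => c) A = mass w A - c * (L.filter (· ∈ A)).card := by
  classical
  have hcard : mass ((L : Set α).indicator fun _ => c) A = c * (L.filter (· ∈ A)).card := by
    rw [mass, Set.indicator_indicator, Set.inter_comm]
    simp [Set.indicator_apply, ← Finset.mem_filter, mul_comm]
  rw [← hcard, mass, mass, mass, ← Finset.sum_sub_distrib]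
  simp only [Set.indicator_sub', Pi.sub_apply]

theorem card_le_sum_of_mass_fiber (hw : ∀ p, 0 ≤ w p) (hx : 0 < x)
    (hs : ∀ i, mass w {p | s p = i} = x) (ht : ∀ j, mass w {p | t p = j} = x * n j)
    {S : Finset I} {T : Finset J} (hST : ∀ p, w p ≠ 0 → s p ∈ S → t p ∈ T) :
    S.card ≤ ∑ j ∈ T, n j := by
  have hle : mass w {p | s p ∈ S} ≤ mass w {p | t p ∈ T} :=
    calc mass w {p | s p ∈ S} = mass w ({p | s p ∈ S} ∩ {p | t p ∈ T}) :=
          mass_congr fun p hp => ⟨fun h => ⟨h, hST p hp h⟩, And.left⟩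
      _ ≤ mass w {p | t p ∈ T} := mass_mono hw Set.inter_subset_right
  simp only [mass_setOf_mem, hs, ht, Finset.sum_const, nsmul_eq_mul, ← Finset.mul_sum,
    mul_comm _ x] at hle
  exact_mod_cast le_of_mul_le_mul_left hle hx

theorem card_eq_sum_of_mass_fiber [Fintype I] [Fintype J] (hx : x ≠ 0)
    (hs : ∀ i, mass w {p | s p = i} = x) (ht : ∀ j, mass w {p | t p = j} = x * n j) :
    Fintype.card I = ∑ j, n j := by
  have hsum : mass w {p | s p ∈ Finset.univ} = mass w {p | t p ∈ Finset.univ} := by simp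
  simp only [mass_setOf_mem, hs, ht, Finset.sum_const, nsmul_eq_mul, ← Finset.mul_sum,
    mul_comm _ x, Finset.card_univ] at hsum
  exact_mod_cast mul_left_cancel₀ hx hsum

theorem exists_bijective_sigma_of_mass_fiber [Finite I] [Finite J] (hw : ∀ p, 0 ≤ w p)
    (hx : 0 < x) (hs : ∀ i, mass w {p | s p = i} = x)
    (ht : ∀ j, mass w {p | t p = j} = x * n j) :
    ∃ f : I → Σ j, Fin (n j), f.Bijective ∧ ∀ i, ∃ p, s p = i ∧ t p = (f i).1 ∧ w p ≠ 0 := by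
  classical
  have := Fintype.ofFinite I
  have := Fintype.ofFinite J
  let slots (i : I) : Finset (Σ j, Fin (n j)) := {y | ∃ p, s p = i ∧ t p = y.1 ∧ w p ≠ 0}
  have hall (S : Finset I) : S.card ≤ (S.biUnion slots).card := by
    let T : Finset J := {j | ∃ p, s p ∈ S ∧ t p = j ∧ w p ≠ 0}
    have hT : S.biUnion slots = T.sigma fun _ => Finset.univ := by
      ext y
      simp only [slots, T, Finset.mem_biUnion, Finset.mem_sigma, Finset.mem_filter_univ,
        Finset.mem_univ, and_true]
      exact ⟨fun ⟨_, hi, p, hp, h⟩ => ⟨p, hp ▸ hi, h⟩, fun ⟨p, hp, h⟩ => ⟨s p, hp, p, rfl, h⟩⟩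
    rw [hT, Finset.card_sigma]
    simpa using card_le_sum_of_mass_fiber hw hx hs ht (S := S) (T := T)
      fun p hp hpS => Finset.mem_filter_univ _ |>.2 ⟨p, hpS, rfl, hp⟩
  obtain ⟨f, hf, hmem⟩ := (Finset.all_card_le_biUnion_card_iff_exists_injective slots).1 hall
  refine ⟨f, (Fintype.bijective_iff_injective_and_card f).2 ⟨hf, ?_⟩,
    fun i => by simpa [slots] using hmem i⟩
  simp [card_eq_sum_of_mass_fiber hx.ne' hs ht]

theorem exists_transversal_of_mass_fiber [Fintype I] [Finite J] [DecidableEq J]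
    (hw : ∀ p, 0 ≤ w p) (hx : 0 < x) (hs : ∀ i, mass w {p | s p = i} = x)
    (ht : ∀ j, mass w {p | t p = j} = x * n j) :
    ∃ P : I → α, (∀ i, s (P i) = i) ∧ (∀ i, w (P i) ≠ 0) ∧
      ∀ j, Finset.card {i | t (P i) = j} = n j := by
  obtain ⟨f, hf, hP⟩ := exists_bijective_sigma_of_mass_fiber hw hx hs ht
  choose P hPs hPt hPw using hP
  have := Fintype.ofFinite J
  refine ⟨P, hPs, hPw, fun j => ?_⟩
  calc Finset.card {i | t (P i) = j}
      = Finset.card {y : Σ j, Fin (n j) | y.1 = j} :=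
        Finset.card_bijective f hf fun i => by simp [hPt]
    _ = n j := by
      rw [Finset.card_filter, Fintype.sum_sigma]
      simp [apply_ite Finset.card]

end Transversal

variable {a : V → ℤ}

namespace IsLayering

variable {L M : Finset G.Route}

theorem exists_mem_src_eq (hL : G.IsLayering a L) {i : V} (hi : G.IsSource i) :
    ∃ p ∈ L, p.src = i := by
  classical
  obtain ⟨p, hp⟩ := Finset.card_pos.1 (Nat.one_pos.trans_eq (hL.source i hi).symm)
  exact ⟨p, Finset.mem_filter.1 hp⟩

theorem eq_of_src_eq (hL : G.IsLayering a L) {p q : G.Route} (hp : p ∈ L) (hq : q ∈ L)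
    (h : p.src = q.src) : p = q := by
  classical
  exact Finset.card_le_one.1 (hL.source q.src q.isSource).le p (Finset.mem_filter.2 ⟨hp, h⟩) q
    (Finset.mem_filter.2 ⟨hq, rfl⟩)

theorem eq_of_forall_eq (hL : G.IsLayering a L) (hM : G.IsLayering a M)
    (h : ∀ p ∈ L, ∀ q ∈ M, p.src = q.src → p = q) : L = M := by
  refine Finset.Subset.antisymm (fun p hp => ?_) fun q hq => ?_
  · obtain ⟨q, hq, hqp⟩ := hM.exists_mem_src_eq p.isSource
    exact h p hp q hq hqp.symm ▸ hq
  · obtain ⟨p, hp, hpq⟩ := hL.exists_mem_src_eq q.isSource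
    exact h p hp q hq hpq ▸ hp

theorem exists_maximal_src_of_ne [Finite V] (hL : G.IsLayering a L) (hM : G.IsLayering a M)
    (hne : L ≠ M) (𝓕 : G.Framing) :
    ∃ p ∈ L, ∃ q ∈ M, p.src = q.src ∧ p ≠ q ∧
      ∀ p' ∈ L, ∀ q' ∈ M, p'.src = q'.src → 𝓕.srcLt p.src p'.src → p' = q' := by
  have := 𝓕.srcLt_total
  let S : Set {i // G.IsSource i} := {i | ∃ p ∈ L, ∃ q ∈ M, p.src = i ∧ q.src = i ∧ p ≠ q}
  have hS : S.Nonempty := by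
    by_contra hS
    refine hne (hL.eq_of_forall_eq hM fun p hp q hq hpq => ?_)
    by_contra hpq'
    exact hS ⟨⟨p.src, p.isSource⟩, p, hp, q, hq, rfl, hpq.symm, hpq'⟩
  obtain ⟨i, ⟨p, hp, q, hq, hpi, hqi, hpq⟩, hmax⟩ :=
    (Finite.wellFounded_of_trans_of_irrefl
      (Function.swap fun i j : {i // G.IsSource i} => 𝓕.srcLt i j)).has_min S hS
  refine ⟨p, hp, q, hq, hpi.trans hqi.symm, hpq, fun p' hp' q' hq' hsrc hlt => ?_⟩
  by_contra hne'
  exact hmax ⟨p'.src, p'.isSource⟩ ⟨p', hp', q', hq', rfl, hsrc.symm, hne'⟩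
    (show 𝓕.srcLt i p'.src from hpi ▸ hlt)

end IsLayering

namespace Framing

variable {𝓕 : G.Framing} {L M N : Finset G.Route}

theorem layeringLt_irrefl (hL : G.IsLayering a L) : ¬ 𝓕.LayeringLt L L := by
  rintro ⟨p, hp, q, hq, hpq, hlt, -⟩
  rw [hL.eq_of_src_eq hp hq hpq] at hlt
  exact 𝓕.postLt_irrefl _ hlt

theorem layeringLt_trans (hL : G.IsLayering a L) (hM : G.IsLayering a M) (hN : G.IsLayering a N)
    (h : 𝓕.LayeringLt L M) (h' : 𝓕.LayeringLt M N) : 𝓕.LayeringLt L N := by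
  obtain ⟨p, hp, q, hq, hpq, hlt, habove⟩ := h
  obtain ⟨q', hq', r, hr, hqr, hlt', habove'⟩ := h'
  have hagree : ∀ p' ∈ L, ∀ r' ∈ N, p'.src = r'.src → 𝓕.srcLt p.src p'.src →
      𝓕.srcLt q'.src p'.src → p' = r' := by
    intro p' hp' r' hr' hsrc h₁ h₂
    obtain ⟨m, hm, hms⟩ := hM.exists_mem_src_eq p'.isSource
    rw [habove p' hp' m hm hms.symm h₁]
    exact habove' m hm r' hr' (hms.trans hsrc) (hms ▸ h₂)
  by_cases hsrc : p.src = q'.src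
  · obtain rfl := hM.eq_of_src_eq hq hq' (hpq ▸ hsrc)
    refine ⟨p, hp, r, hr, hpq.trans hqr, ?_, fun p' hp' r' hr' hs h₁ =>
      hagree p' hp' r' hr' hs h₁ (hsrc ▸ h₁)⟩
    exact 𝓕.postLt_trans p.isPath (hpq ▸ q.isPath) ((hpq.trans hqr) ▸ r.isPath) hlt hlt'
  · rcases 𝓕.srcLt_or_srcLt p.isSource q'.isSource hsrc with hpq' | hqp
    · obtain ⟨p', hp', hs⟩ := hL.exists_mem_src_eq q'.isSource
      obtain rfl := habove p' hp' q' hq' hs (hs ▸ hpq')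
      exact ⟨p', hp', r, hr, hqr, hlt', fun p'' hp'' r' hr' hs h₁ => hagree p'' hp'' r' hr' hs
        (𝓕.srcLt_trans p.isSource p'.isSource p''.isSource hpq' h₁) h₁⟩
    · obtain ⟨r', hr', hs⟩ := hN.exists_mem_src_eq q.isSource
      obtain rfl := habove' q hq r' hr' hs.symm (hpq ▸ hqp)
      exact ⟨p, hp, q, hr', hpq, hlt, fun p'' hp'' r' hr' hs h₁ => hagree p'' hp'' r' hr' hs h₁
        (𝓕.srcLt_trans q'.isSource p.isSource p''.isSource hqp h₁)⟩

theorem layeringLt_asymm (hL : G.IsLayering a L) (hM : G.IsLayering a M)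
    (h : 𝓕.LayeringLt L M) : ¬ 𝓕.LayeringLt M L :=
  fun h' => layeringLt_irrefl hL (layeringLt_trans hL hM hL h h')

theorem layeringLt_or_layeringLt [Finite V] (hL : G.IsLayering a L) (hM : G.IsLayering a M)
    (hne : L ≠ M) : 𝓕.LayeringLt L M ∨ 𝓕.LayeringLt M L := by
  obtain ⟨p, hp, q, hq, hsrc, hpq, habove⟩ := hL.exists_maximal_src_of_ne hM hne 𝓕
  have hedges : p.edges ≠ q.edges := fun h => hpq (Route.eq_of_src_eq_of_edges_eq hsrc h)
  rcases 𝓕.postLt_total p.isPath p.isSink (hsrc ▸ q.isPath) q.isSink hedges with hlt | hlt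
  · exact Or.inl ⟨p, hp, q, hq, hsrc, hlt, habove⟩
  · exact Or.inr ⟨q, hq, p, hp, hsrc.symm, hlt, fun q' hq' p' hp' hs hlt' =>
      (habove p' hp' q' hq' hs.symm (hsrc ▸ hs ▸ hlt')).symm⟩

theorem exists_least_layering [Finite V] {S : Set (Finset G.Route)} (hfin : S.Finite)
    (hne : S.Nonempty) (hS : ∀ L ∈ S, G.IsLayering a L) :
    ∃ L ∈ S, ∀ M ∈ S, L = M ∨ 𝓕.LayeringLt L M := by
  have := hfin.to_subtype
  let r (L M : S) : Prop := 𝓕.LayeringLt L M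
  have : IsTrans S r := ⟨fun L M N => layeringLt_trans (hS L L.2) (hS M M.2) (hS N N.2)⟩
  have : Std.Irrefl r := ⟨fun L => layeringLt_irrefl (hS L L.2)⟩
  obtain ⟨L, -, hL⟩ := (Finite.wellFounded_of_trans_of_irrefl r).has_min Set.univ
    ⟨⟨_, hne.some_mem⟩, Set.mem_univ _⟩
  refine ⟨L, L.2, fun M hM => or_iff_not_imp_left.2 fun hLM => ?_⟩
  exact (layeringLt_or_layeringLt (hS L L.2) (hS M hM) hLM).resolve_right
    (hL ⟨M, hM⟩ (Set.mem_univ _))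

end Framing

section Balanced

variable [Fintype G.Route] {x : ℝ} {w : G.Route → ℝ}

/-- Nonnegative route weights of total `x` at each source and total `x * |a j|` at each sink `j`,
as they arise from a flow with netflow `x * a`. -/
structure IsBalanced (a : V → ℤ) (x : ℝ) (w : G.Route → ℝ) : Prop where
  nonneg : ∀ p, 0 ≤ w p
  source : ∀ i, G.IsSource i → mass w {p | p.src = i} = x
  sink : ∀ j, G.IsSink j → mass w {p | p.snk = j} = x * (a j).natAbs

namespace IsBalanced

theorem pos_of_ne_zero (hw : IsBalanced a x w) {p : G.Route} (hp : w p ≠ 0) : 0 < x :=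
  calc 0 < w p := (hw.nonneg p).lt_of_ne' hp
    _ = mass w {p} := (mass_singleton p).symm
    _ ≤ mass w {q | q.src = p.src} := mass_mono hw.nonneg (by simp)
    _ = x := hw.source _ p.isSource

theorem exists_isLayering [Finite V] (hw : IsBalanced a x w) (hx : 0 < x) :
    ∃ L : Finset G.Route, G.IsLayering a L ∧ ∀ p ∈ L, w p ≠ 0 := by
  classical
  have := Fintype.ofFinite V
  obtain ⟨P, hPsrc, hPw, hPsnk⟩ := exists_transversal_of_mass_fiber (I := {i // G.IsSource i})
    (J := {j // G.IsSink j}) (s := fun p : G.Route => ⟨p.src, p.isSource⟩)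
    (t := fun p => ⟨p.snk, p.isSink⟩)
    (n := fun j => (a j).natAbs) hw.nonneg hx
    (fun i => by simpa only [Subtype.ext_iff] using hw.source i i.2)
    (fun j => by simpa only [Subtype.ext_iff] using hw.sink j j.2)
  simp only [Subtype.ext_iff] at hPsrc hPsnk
  have hPinj : P.Injective := fun i i' h => Subtype.ext (by rw [← hPsrc i, h, hPsrc])
  refine ⟨Finset.univ.map ⟨P, hPinj⟩, ⟨fun i hi => ?_, fun j hj => ?_⟩, ?_⟩
  · rw [Finset.filter_map, Finset.card_map, Finset.card_eq_one]
    refine ⟨⟨i, hi⟩, ?_⟩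
    ext i'
    simp [hPsrc, Subtype.ext_iff]
  · rw [Finset.filter_map, Finset.card_map, Int.abs_eq_natAbs]
    exact congrArg Nat.cast (hPsnk ⟨j, hj⟩)
  · intro p hp
    obtain ⟨i, -, rfl⟩ := Finset.mem_map.1 hp
    exact hPw i

theorem exists_least_isLayering [Finite V] {𝓕 : G.Framing} (hw : IsBalanced a x w) (hx : 0 < x) :
    ∃ L : Finset G.Route, G.IsLayering a L ∧ (∀ p ∈ L, w p ≠ 0) ∧
      ∀ M : Finset G.Route, G.IsLayering a M → (∀ p ∈ M, w p ≠ 0) →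
        L = M ∨ 𝓕.LayeringLt L M := by
  obtain ⟨L, hL, hmin⟩ := Framing.exists_least_layering (𝓕 := 𝓕)
    (S := {L | G.IsLayering a L ∧ ∀ p ∈ L, w p ≠ 0}) (Set.toFinite _) (hw.exists_isLayering hx)
    fun L hL => hL.1
  exact ⟨L, hL.1, hL.2, fun M hM hMw => hmin M ⟨hM, hMw⟩⟩

theorem sub_indicator (hw : IsBalanced a x w) {L : Finset G.Route} (hL : G.IsLayering a L)
    {c : ℝ} (hc : ∀ p ∈ L, c ≤ w p) :
    IsBalanced a (x - c) (w - (L : Set G.Route).indicator fun _ => c) := by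
  classical
  refine ⟨fun p => ?_, fun i hi => ?_, fun j hj => ?_⟩
  · by_cases hp : p ∈ L
    · simp [hp, hc p hp]
    · simp [hp, hw.nonneg p]
  · rw [mass_sub_indicator, hw.source i hi]
    simp [hL.source i hi]
  · have hcard : (L.filter fun p => p.snk = j).card = (a j).natAbs := by
      exact_mod_cast (hL.sink j hj).trans (Int.abs_eq_natAbs _)
    rw [mass_sub_indicator, hw.sink j hj]
    simp only [Set.mem_ofPred_eq, hcard]
    ring

end IsBalanced

end Balanced

/-! ### Layering-simplices -/

/-- The weight of each route in the combination of the layerings in `𝓛` with coefficients `c`. -/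
noncomputable def routeCoeff (𝓛 : Finset (Finset G.Route)) (c : Finset G.Route → ℝ) :
    G.Route → ℝ :=
  ∑ L ∈ 𝓛, (L : Set G.Route).indicator fun _ => c L

section RouteCoeff

variable {𝓛 : Finset (Finset G.Route)} {c : Finset G.Route → ℝ} {L : Finset G.Route} {p : G.Route}

theorem routeCoeff_insert [DecidableEq (Finset G.Route)] (hL : L ∉ 𝓛) :
    routeCoeff (insert L 𝓛) c = (L : Set G.Route).indicator (fun _ => c L) + routeCoeff 𝓛 c :=
  Finset.sum_insert hL

theorem routeCoeff_congr {c' : Finset G.Route → ℝ} (h : ∀ L ∈ 𝓛, c L = c' L) :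
    routeCoeff 𝓛 c = routeCoeff 𝓛 c' :=
  Finset.sum_congr rfl fun L hL => by rw [h L hL]

theorem routeCoeff_nonneg (hc : ∀ L ∈ 𝓛, 0 < c L) (p : G.Route) : 0 ≤ routeCoeff 𝓛 c p := by
  rw [routeCoeff, Finset.sum_apply]
  exact Finset.sum_nonneg fun L hL => Set.indicator_nonneg (fun _ _ => (hc L hL).le) p

theorem le_routeCoeff (hc : ∀ L ∈ 𝓛, 0 < c L) (hL : L ∈ 𝓛) (hp : p ∈ L) :
    c L ≤ routeCoeff 𝓛 c p := by
  rw [routeCoeff, Finset.sum_apply]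
  calc c L = (L : Set G.Route).indicator (fun _ => c L) p := by simp [hp]
    _ ≤ _ := Finset.single_le_sum
      (f := fun K : Finset G.Route => (K : Set G.Route).indicator (fun _ => c K) p)
      (fun K hK => Set.indicator_nonneg (fun _ _ => (hc K hK).le) p) hL

theorem routeCoeff_eq_zero (hp : p ∉ routesOf (𝓛 : Set (Finset G.Route))) :
    routeCoeff 𝓛 c p = 0 := by
  rw [routeCoeff, Finset.sum_apply]
  exact Finset.sum_eq_zero fun L hL => Set.indicator_of_notMem (fun hpL => hp ⟨L, hL, hpL⟩) _

theorem support_routeCoeff (hc : ∀ L ∈ 𝓛, 0 < c L) :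
    {p | routeCoeff 𝓛 c p ≠ 0} = routesOf (𝓛 : Set (Finset G.Route)) := by
  ext p
  refine ⟨not_imp_comm.1 routeCoeff_eq_zero, ?_⟩
  rintro ⟨L, hL, hp⟩
  exact ((hc L hL).trans_le (le_routeCoeff hc hL hp)).ne'

theorem sum_smul_layeringIndicator [Fintype G.Route] (𝓛 : Finset (Finset G.Route))
    (c : Finset G.Route → ℝ) :
    ∑ L ∈ 𝓛, c L • layeringIndicator L = ∑ p, routeCoeff 𝓛 c p • p.indicator := by
  classical
  simp only [routeCoeff, Finset.sum_apply, Finset.sum_smul]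
  rw [Finset.sum_comm]
  refine Finset.sum_congr rfl fun L _ => ?_
  simp [layeringIndicator, Finset.smul_sum, Set.indicator_apply, ite_smul, Finset.sum_ite_mem]

end RouteCoeff

section SubIndicator

variable {α : Type*} {w : α → ℝ} {L : Finset α} {m : α}

theorem support_sub_indicator_ssubset (hL : ∀ p ∈ L, w p ≠ 0) (hm : m ∈ L) :
    {p | (w - (L : Set α).indicator fun _ => w m) p ≠ 0} ⊂ {p | w p ≠ 0} := by
  refine (Set.ssubset_iff_of_subset fun p hp => ?_).2 ⟨m, hL m hm, by simp [hm]⟩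
  by_cases hpL : p ∈ L
  · exact hL p hpL
  · simpa [hpL] using hp

theorem closure_range_sub_indicator_le :
    AddSubgroup.closure (Set.range (w - (L : Set α).indicator fun _ => w m)) ≤
      AddSubgroup.closure (Set.range w) := by
  classical
  rw [AddSubgroup.closure_le]
  rintro _ ⟨p, rfl⟩
  have hmem (q : α) : w q ∈ AddSubgroup.closure (Set.range w) :=
    AddSubgroup.subset_closure ⟨q, rfl⟩
  rw [Pi.sub_apply, Set.indicator_apply]
  split_ifs
  exacts [sub_mem (hmem p) (hmem m), sub_mem (hmem p) (zero_mem _)]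

end SubIndicator

theorem routesOf_mono {𝓐 𝓑 : Set (Finset G.Route)} (h : 𝓐 ⊆ 𝓑) : routesOf 𝓐 ⊆ routesOf 𝓑 :=
  fun _ ⟨L, hL, hp⟩ => ⟨L, h hL, hp⟩

namespace Framing

variable {𝓕 : G.Framing} {L : Finset G.Route} {𝓜 𝓛 : Finset (Finset G.Route)}

/-- `L` can be put in front of the layering-simplex `𝓜`: these are the conditions under which
`insert L 𝓜` is a layering-simplex with least element `L`. -/
structure IsPrependable (𝓕 : G.Framing) (a : V → ℤ) (L : Finset G.Route)
    (𝓜 : Finset (Finset G.Route)) : Prop where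
  isLayering : G.IsLayering a L
  simplex : 𝓕.IsLayeringSimplex a 𝓜
  clique : 𝓕.IsRouteClique (routesOf (insert L (𝓜 : Set (Finset G.Route))))
  le : ∀ M : Finset G.Route, G.IsLayering a M →
    (M : Set G.Route) ⊆ routesOf (insert L (𝓜 : Set (Finset G.Route))) →
    L = M ∨ 𝓕.LayeringLt L M
  exists_new : ∃ p ∈ L, p ∉ routesOf (𝓜 : Set (Finset G.Route))

theorem isLayeringSimplex_empty : 𝓕.IsLayeringSimplex a ∅ where
  isLayering := by simp
  clique := by simp [routesOf, IsRouteClique]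
  isMin := by simp
  exists_new := by simp

theorem setOf_layeringLt_insert [DecidableEq (Finset G.Route)] {K : Finset G.Route}
    (h : ¬ 𝓕.LayeringLt K L) :
    {K' | K' ∈ insert L 𝓜 ∧ 𝓕.LayeringLt K K'} = {K' | K' ∈ 𝓜 ∧ 𝓕.LayeringLt K K'} := by
  ext K'
  simp only [Finset.mem_insert, Set.mem_ofPred_eq]
  grind

theorem setOf_eq_or_layeringLt_insert [DecidableEq (Finset G.Route)] {K : Finset G.Route}
    (hne : L ≠ K) (h : ¬ 𝓕.LayeringLt K L) :
    {K' | K' ∈ insert L 𝓜 ∧ (K' = K ∨ 𝓕.LayeringLt K K')} =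
      {K' | K' ∈ 𝓜 ∧ (K' = K ∨ 𝓕.LayeringLt K K')} := by
  ext K'
  simp only [Finset.mem_insert, Set.mem_ofPred_eq]
  grind

namespace IsPrependable

theorem notMem (h : 𝓕.IsPrependable a L 𝓜) : L ∉ 𝓜 := fun hL =>
  let ⟨_, hp, hnew⟩ := h.exists_new
  hnew ⟨L, hL, hp⟩

theorem layeringLt (h : 𝓕.IsPrependable a L 𝓜) {K : Finset G.Route} (hK : K ∈ 𝓜) :
    𝓕.LayeringLt L K :=
  (h.le K (h.simplex.isLayering K hK) fun _ hp => ⟨K, Or.inr hK, hp⟩).resolve_left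
    fun hLK => h.notMem (hLK ▸ hK)

theorem isLayeringSimplex_insert [DecidableEq (Finset G.Route)] (h : 𝓕.IsPrependable a L 𝓜) :
    𝓕.IsLayeringSimplex a (insert L 𝓜) := by
  have hne {K} (hK : K ∈ 𝓜) : L ≠ K := fun hLK => h.notMem (hLK ▸ hK)
  have hnlt {K} (hK : K ∈ 𝓜) : ¬ 𝓕.LayeringLt K L :=
    layeringLt_asymm h.isLayering (h.simplex.isLayering K hK) (h.layeringLt hK)
  refine ⟨?_, by simpa using h.clique, ?_, ?_⟩ <;> rw [Finset.forall_mem_insert]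
  · exact ⟨h.isLayering, h.simplex.isLayering⟩
  · refine ⟨fun M hM hsub => h.le M hM (hsub.trans (routesOf_mono ?_)), fun K hK M hM hsub => ?_⟩
    · exact fun K hK => by simpa using hK.1
    · rw [setOf_eq_or_layeringLt_insert (hne hK) (hnlt hK)] at hsub
      exact h.simplex.isMin K hK M hM hsub
  · refine ⟨?_, fun K hK => ?_⟩
    · obtain ⟨p, hp, hnew⟩ := h.exists_new
      rw [setOf_layeringLt_insert (layeringLt_irrefl h.isLayering)]
      exact ⟨p, hp, fun hp' => hnew (routesOf_mono (fun K hK => hK.1) hp')⟩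
    · rw [setOf_layeringLt_insert (hnlt hK)]
      exact h.simplex.exists_new K hK

theorem exists_routeCoeff_eq [DecidableEq (Finset G.Route)] (h : 𝓕.IsPrependable a L 𝓜)
    (c : Finset G.Route → ℝ) : ∃ p ∈ L, routeCoeff (insert L 𝓜) c p = c L := by
  obtain ⟨p, hp, hnew⟩ := h.exists_new
  exact ⟨p, hp, by simp [routeCoeff_insert h.notMem, routeCoeff_eq_zero hnew, hp]⟩

variable {L₁ L₂ : Finset G.Route} {𝓜₁ 𝓜₂ : Finset (Finset G.Route)}

theorem eq_of_routesOf_eq (h₁ : 𝓕.IsPrependable a L₁ 𝓜₁) (h₂ : 𝓕.IsPrependable a L₂ 𝓜₂)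
    (h : routesOf (insert L₁ (𝓜₁ : Set (Finset G.Route))) =
      routesOf (insert L₂ (𝓜₂ : Set (Finset G.Route)))) : L₁ = L₂ := by
  rcases h₁.le L₂ h₂.isLayering (h ▸ fun _ hp => ⟨L₂, Or.inl rfl, hp⟩) with heq | hlt
  · exact heq
  rcases h₂.le L₁ h₁.isLayering (h ▸ fun _ hp => ⟨L₁, Or.inl rfl, hp⟩) with heq | hlt'
  · exact heq.symm
  · exact absurd hlt' (layeringLt_asymm h₁.isLayering h₂.isLayering hlt)

theorem coeff_le [DecidableEq (Finset G.Route)] {c₁ c₂ : Finset G.Route → ℝ}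
    (h₂ : 𝓕.IsPrependable a L 𝓜₂) (hc₁ : ∀ K ∈ insert L 𝓜₁, 0 < c₁ K)
    (h : routeCoeff (insert L 𝓜₁) c₁ = routeCoeff (insert L 𝓜₂) c₂) : c₁ L ≤ c₂ L := by
  obtain ⟨p, hp, hpc⟩ := h₂.exists_routeCoeff_eq c₂
  rw [← hpc, ← h]
  exact le_routeCoeff hc₁ (Finset.mem_insert_self _ _) hp

end IsPrependable

namespace IsLayeringSimplex

theorem of_insert [DecidableEq (Finset G.Route)] (h : 𝓕.IsLayeringSimplex a (insert L 𝓜))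
    (hL : L ∉ 𝓜) (hlt : ∀ K ∈ 𝓜, 𝓕.LayeringLt L K) : 𝓕.IsLayeringSimplex a 𝓜 := by
  obtain ⟨hlayer, hclique, hmin, hnew⟩ := h
  rw [Finset.forall_mem_insert] at hlayer hmin hnew
  have hnlt {K} (hK : K ∈ 𝓜) : ¬ 𝓕.LayeringLt K L :=
    layeringLt_asymm hlayer.1 (hlayer.2 K hK) (hlt K hK)
  refine ⟨hlayer.2, hclique.mono (routesOf_mono (by simp)), fun K hK M hM hsub => ?_,
    fun K hK => ?_⟩
  · refine hmin.2 K hK M hM ?_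
    have hne : L ≠ K := fun hLK => hL (hLK ▸ hK)
    rwa [setOf_eq_or_layeringLt_insert hne (hnlt hK)]
  · rw [← setOf_layeringLt_insert (hnlt hK)]
    exact hnew.2 K hK

theorem exists_eq_insert [Finite V] [DecidableEq (Finset G.Route)] (h : 𝓕.IsLayeringSimplex a 𝓛)
    (hne : 𝓛.Nonempty) : ∃ L 𝓜, 𝓕.IsPrependable a L 𝓜 ∧ 𝓛 = insert L 𝓜 := by
  obtain ⟨L, hL, hmin⟩ := exists_least_layering (𝓕 := 𝓕) 𝓛.finite_toSet hne h.isLayering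
  obtain ⟨𝓜, hL𝓜, rfl⟩ : ∃ 𝓜, L ∉ 𝓜 ∧ 𝓛 = insert L 𝓜 :=
    ⟨𝓛.erase L, Finset.notMem_erase _ _, (Finset.insert_erase hL).symm⟩
  have hlt : ∀ K ∈ 𝓜, 𝓕.LayeringLt L K := fun K hK =>
    (hmin K (Finset.mem_insert_of_mem hK)).resolve_left fun hLK => hL𝓜 (hLK ▸ hK)
  refine ⟨L, 𝓜, ⟨h.isLayering L hL, h.of_insert hL𝓜 hlt, by simpa using h.clique,
    fun M hM hsub => h.isMin L hL M hM (hsub.trans (routesOf_mono ?_)), ?_⟩, rfl⟩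
  · rintro K (rfl | hK)
    · exact ⟨hL, Or.inl rfl⟩
    · exact ⟨Finset.mem_insert_of_mem hK, Or.inr (hlt K hK)⟩
  · obtain ⟨p, hp, hnew⟩ := h.exists_new L hL
    refine ⟨p, hp, fun hp' => hnew (routesOf_mono (fun K hK => ?_) hp')⟩
    exact ⟨Finset.mem_insert_of_mem hK, hlt K hK⟩

theorem routesOf_eq_empty_iff (h : 𝓕.IsLayeringSimplex a 𝓛) :
    routesOf (𝓛 : Set (Finset G.Route)) = ∅ ↔ 𝓛 = ∅ := by
  constructor
  · refine fun h𝓛 => Finset.eq_empty_of_forall_notMem fun L hL => ?_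
    obtain ⟨p, hp, -⟩ := h.exists_new L hL
    exact h𝓛.subset ⟨L, hL, hp⟩
  · rintro rfl
    simp [routesOf]

variable {𝓛₁ 𝓛₂ : Finset (Finset G.Route)} {c₁ c₂ : Finset G.Route → ℝ}

theorem unique [Finite V] (h₁ : 𝓕.IsLayeringSimplex a 𝓛₁) (h₂ : 𝓕.IsLayeringSimplex a 𝓛₂)
    (hc₁ : ∀ L ∈ 𝓛₁, 0 < c₁ L) (hc₂ : ∀ L ∈ 𝓛₂, 0 < c₂ L)
    (h : routeCoeff 𝓛₁ c₁ = routeCoeff 𝓛₂ c₂) : 𝓛₁ = 𝓛₂ ∧ ∀ L ∈ 𝓛₁, c₁ L = c₂ L := by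
  classical
  induction 𝓛₁ using Finset.strongInduction generalizing 𝓛₂ with
  | H 𝓛₁ ih =>
    have hroutes : routesOf (𝓛₁ : Set (Finset G.Route)) = routesOf (𝓛₂ : Set (Finset G.Route)) := by
      rw [← support_routeCoeff hc₁, ← support_routeCoeff hc₂, h]
    have hempty : 𝓛₁ = ∅ ↔ 𝓛₂ = ∅ := by
      rw [← h₁.routesOf_eq_empty_iff, ← h₂.routesOf_eq_empty_iff, hroutes]
    rcases 𝓛₁.eq_empty_or_nonempty with rfl | hne₁
    · exact ⟨(hempty.1 rfl).symm, by simp⟩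
    have hne₂ : 𝓛₂.Nonempty := Finset.nonempty_iff_ne_empty.2 (mt hempty.2 hne₁.ne_empty)
    obtain ⟨L, 𝓜₁, hL₁, rfl⟩ := h₁.exists_eq_insert hne₁
    obtain ⟨L₂, 𝓜₂, hL₂, rfl⟩ := h₂.exists_eq_insert hne₂
    obtain rfl : L = L₂ := hL₁.eq_of_routesOf_eq hL₂ (by simpa using hroutes)
    have hcL : c₁ L = c₂ L := (hL₂.coeff_le hc₁ h).antisymm (hL₁.coeff_le hc₂ h.symm)
    rw [routeCoeff_insert hL₁.notMem, routeCoeff_insert hL₂.notMem, hcL, add_right_inj] at h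
    rw [Finset.forall_mem_insert] at hc₁ hc₂
    obtain ⟨rfl, hc⟩ := ih 𝓜₁ (Finset.ssubset_insert hL₁.notMem) hL₁.simplex hL₂.simplex
      hc₁.2 hc₂.2 h
    exact ⟨rfl, Finset.forall_mem_insert .. |>.2 ⟨hcL, hc⟩⟩

end IsLayeringSimplex

theorem isPrependable_of_subset {R : Set G.Route} (hR : 𝓕.IsRouteClique R)
    (hL : G.IsLayering a L) (hLR : (L : Set G.Route) ⊆ R)
    (hmin : ∀ M : Finset G.Route, G.IsLayering a M → (M : Set G.Route) ⊆ R →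
      L = M ∨ 𝓕.LayeringLt L M)
    (h𝓜 : 𝓕.IsLayeringSimplex a 𝓜) (h𝓜R : routesOf (𝓜 : Set (Finset G.Route)) ⊆ R)
    (hnew : ∃ p ∈ L, p ∉ routesOf (𝓜 : Set (Finset G.Route))) : 𝓕.IsPrependable a L 𝓜 := by
  have hsubR : routesOf (insert L (𝓜 : Set (Finset G.Route))) ⊆ R := by
    rintro p ⟨K, rfl | hK, hp⟩
    exacts [hLR hp, h𝓜R ⟨K, hK, hp⟩]
  exact ⟨hL, h𝓜, hR.mono hsubR, fun M hM hsub => hmin M hM (hsub.trans hsubR), hnew⟩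

variable [Finite V] [Fintype G.Route] {x : ℝ} {w : G.Route → ℝ}

theorem exists_isLayeringSimplex (hw : IsBalanced a x w) (hR : 𝓕.IsRouteClique {p | w p ≠ 0}) :
    ∃ (𝓛 : Finset (Finset G.Route)) (c : Finset G.Route → ℝ),
      𝓕.IsLayeringSimplex a 𝓛 ∧ (∀ L ∈ 𝓛, 0 < c L) ∧ routeCoeff 𝓛 c = w ∧
      ∀ L ∈ 𝓛, c L ∈ AddSubgroup.closure (Set.range w) := by
  classical
  induction hS : {p | w p ≠ 0} using WellFoundedLT.induction generalizing x w with
  | ind S ih =>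
    subst hS
    rcases eq_or_ne w 0 with rfl | hw0
    · exact ⟨∅, 0, isLayeringSimplex_empty, by simp, by simp [routeCoeff], by simp⟩
    obtain ⟨p₀, hp₀⟩ := Function.ne_iff.1 hw0
    obtain ⟨L, hL, hLw, hmin⟩ := hw.exists_least_isLayering (𝓕 := 𝓕) (hw.pos_of_ne_zero hp₀)
    obtain ⟨q, hq, -⟩ := hL.exists_mem_src_eq p₀.isSource
    obtain ⟨m, hm, hmle⟩ := L.exists_min_image w ⟨q, hq⟩
    set w' : G.Route → ℝ := w - (L : Set G.Route).indicator fun _ => w m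
    have hw'm : w' m = 0 := by simp [w', hm]
    have hsupp : {p | w' p ≠ 0} ⊂ {p | w p ≠ 0} :=
      support_sub_indicator_ssubset hLw hm
    obtain ⟨𝓜, c, h𝓜, hc, hcw', hcl⟩ :=
      ih _ hsupp (hw.sub_indicator hL hmle) (hR.mono hsupp.subset) rfl
    have hroutes : routesOf (𝓜 : Set (Finset G.Route)) = {p | w' p ≠ 0} := by
      rw [← support_routeCoeff hc, hcw']
    have hL𝓜 : 𝓕.IsPrependable a L 𝓜 := isPrependable_of_subset hR hL hLw hmin h𝓜
      (hroutes ▸ hsupp.subset) ⟨m, hm, by simp [hroutes, hw'm]⟩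
    have hrange : AddSubgroup.closure (Set.range w') ≤ AddSubgroup.closure (Set.range w) :=
      closure_range_sub_indicator_le
    have hupdate : ∀ K ∈ 𝓜, Function.update c L (w m) K = c K := fun K hK =>
      Function.update_of_ne (ne_of_mem_of_not_mem hK hL𝓜.notMem) _ _
    refine ⟨insert L 𝓜, Function.update c L (w m), hL𝓜.isLayeringSimplex_insert, ?_, ?_, ?_⟩
    · rw [Finset.forall_mem_insert, Function.update_self]
      exact ⟨(hw.nonneg m).lt_of_ne' (hLw m hm), fun K hK => hupdate K hK ▸ hc K hK⟩
    · rw [routeCoeff_insert hL𝓜.notMem, routeCoeff_congr hupdate, hcw', Function.update_self,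
        add_sub_cancel]
    · rw [Finset.forall_mem_insert, Function.update_self]
      exact ⟨AddSubgroup.subset_closure ⟨m, rfl⟩, fun K hK => hupdate K hK ▸ hrange (hcl K hK)⟩

end Framing

/-! ### Flows with conservationist netflow -/

section Flow

variable [Fintype E] [DecidableEq V] {b : V → ℝ} {F : E → ℝ} {v : V}

theorem IsFlow.sum_tail_eq_of_isSource (hF : G.IsFlow b F) (hv : G.IsSource v) :
    ∑ e with G.tail e = v, F e = b v := by
  simpa [hv _] using hF.2 v

theorem IsFlow.sum_head_eq_of_isSink (hF : G.IsFlow b F) (hv : G.IsSink v) :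
    ∑ e with G.head e = v, F e = -b v := by
  simpa [hv _, neg_eq_iff_eq_neg] using hF.2 v

theorem IsFlow.isConserved (hF : G.IsFlow b F) (hb : ∀ v, G.IsInternal v → b v = 0) :
    G.IsConserved F :=
  fun v hv => sub_eq_zero.1 ((hF.2 v).trans (hb v hv))

end Flow

variable {v : V}

theorem IsConservationist.not_isSink (ha : G.IsConservationist a) (hv : G.IsSource v) :
    ¬ G.IsSink v := fun hsink => by
  have := ha.source v hv
  have := ha.sink v hsink
  lia

theorem setOf_src_eq (hv : G.IsSource v) (hv' : ¬ G.IsSink v) :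
    {p : G.Route | p.src = v} = routesMeeting {e | G.tail e = v} := by
  ext p
  constructor
  · rintro rfl
    have hp := p.isPath
    rcases hl : p.edges with _ | ⟨e, l⟩
    · rw [hl, isPath_nil_iff] at hp
      exact absurd (hp ▸ p.isSink) hv'
    · rw [hl, isPath_cons_iff] at hp
      exact ⟨e, hp.1, by simp [hl]⟩
  · rintro ⟨e, rfl, he⟩
    obtain ⟨l₁, l₂, -, hl₁, -⟩ := p.isPath.exists_split he
    rw [hv.eq_nil_of_isPath hl₁] at hl₁
    exact isPath_nil_iff.1 hl₁

theorem setOf_snk_eq (hv : G.IsSink v) (hv' : ¬ G.IsSource v) :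
    {p : G.Route | p.snk = v} = routesMeeting {e | G.head e = v} := by
  ext p
  constructor
  · rintro rfl
    have hp := p.isPath
    rcases List.eq_nil_or_concat' p.edges with hl | ⟨l, e, hl⟩
    · rw [hl, isPath_nil_iff] at hp
      exact absurd (hp ▸ p.isSource) hv'
    · rw [hl, isPath_snoc_iff] at hp
      exact ⟨e, hp.2, by simp [hl]⟩
  · rintro ⟨e, rfl, he⟩
    obtain ⟨l₁, l₂, -, -, hl₂⟩ := p.isPath.exists_split he
    rw [hv.eq_nil_of_isPath hl₂] at hl₂
    exact (isPath_nil_iff.1 hl₂).symm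

namespace Framing

variable [Fintype G.Route] {𝓕 : G.Framing} {F : E → ℝ} {w : G.Route → ℝ}

section Balanced

variable [Fintype E] [DecidableEq V]

theorem IsCliqueDecomposition.mass_src_eq (h : 𝓕.IsCliqueDecomposition F w) (hG : G.IsAcyclic)
    (hv : G.IsSource v) (hv' : ¬ G.IsSink v) :
    mass w {p | p.src = v} = ∑ e with G.tail e = v, F e := by
  rw [setOf_src_eq hv hv', ← h.mass_routesMeeting]
  · simp
  · simp only [Finset.mem_filter, Finset.mem_univ, true_and]
    exact fun p e he f hf hep hfp => hG.eq_of_tail_eq p.isPath hep hfp (he.trans hf.symm)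

theorem IsCliqueDecomposition.mass_snk_eq (h : 𝓕.IsCliqueDecomposition F w) (hG : G.IsAcyclic)
    (hv : G.IsSink v) (hv' : ¬ G.IsSource v) :
    mass w {p | p.snk = v} = ∑ e with G.head e = v, F e := by
  rw [setOf_snk_eq hv hv', ← h.mass_routesMeeting]
  · simp
  · simp only [Finset.mem_filter, Finset.mem_univ, true_and]
    exact fun p e he f hf hep hfp => hG.eq_of_head_eq p.isPath hep hfp (he.trans hf.symm)

theorem IsCliqueDecomposition.isBalanced (h : 𝓕.IsCliqueDecomposition F w) (hG : G.IsAcyclic)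
    (ha : G.IsConservationist a) {x : ℝ} (hF : G.IsFlow (fun v => x * (a v : ℝ)) F) :
    IsBalanced a x w where
  nonneg := h.nonneg
  source i hi := by
    rw [h.mass_src_eq hG hi (ha.not_isSink hi), hF.sum_tail_eq_of_isSource hi, ha.source i hi,
      Int.cast_one, mul_one]
  sink j hj := by
    rw [h.mass_snk_eq hG hj fun hj' => ha.not_isSink hj' hj, hF.sum_head_eq_of_isSink hj,
      Nat.cast_natAbs, abs_of_neg (ha.sink j hj), Int.cast_neg, mul_neg]

end Balanced

theorem IsPositiveCombination.isCliqueDecomposition {𝓛 : Finset (Finset G.Route)}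
    {c : Finset G.Route → ℝ} (h : 𝓕.IsPositiveCombination a F 𝓛 c) :
    𝓕.IsCliqueDecomposition F (routeCoeff 𝓛 c) where
  nonneg := routeCoeff_nonneg h.pos
  clique := support_routeCoeff h.pos ▸ h.simplex.clique
  eq_sum := by rw [← sum_smul_layeringIndicator, h.eq_sum]

end Framing

end DiMultigraph

theorem theorem3p12 {V E : Type*} [Fintype V] [DecidableEq V] [Fintype E]
    (G : DiMultigraph V E) (hG : G.IsAcyclic) (a : V → ℤ) (ha : G.IsConservationist a)
    (𝓕 : G.Framing) (x : ℝ) (hx : 0 < x) (F : E → ℝ)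
    (hF : G.IsFlow (fun v => x * (a v : ℝ)) F) :
    ∃ (𝓛 : Finset (Finset G.Route)) (c : Finset G.Route → ℝ),
      𝓕.IsPositiveCombination a F 𝓛 c ∧
      (∀ (𝓛' : Finset (Finset G.Route)) (c' : Finset G.Route → ℝ),
        𝓕.IsPositiveCombination a F 𝓛' c' → 𝓛' = 𝓛 ∧ ∀ L ∈ 𝓛, c' L = c L) ∧
      ((∀ e, ∃ n : ℤ, F e = n) → ∀ L ∈ 𝓛, ∃ n : ℤ, c L = n) := by
  have := DiMultigraph.Route.finite hG
  have := Fintype.ofFinite G.Route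
  have hcons : G.IsConserved F := hF.isConserved fun v hv => by simp [ha.internal v hv]
  have hdec := DiMultigraph.Framing.isCliqueDecomposition_pathWeight (𝓕 := 𝓕) hG hF.1 hcons
  obtain ⟨𝓛, c, h𝓛, hc, hcw, hcl⟩ :=
    DiMultigraph.Framing.exists_isLayeringSimplex (hdec.isBalanced hG ha hF) hdec.clique
  refine ⟨𝓛, c, ⟨h𝓛, hc, ?_⟩, fun 𝓛' c' h' => ?_, fun hint => ?_⟩
  · rw [DiMultigraph.sum_smul_layeringIndicator, hcw, hdec.eq_sum]
  · have hw' : DiMultigraph.routeCoeff 𝓛' c' = fun p => 𝓕.pathWeight F p.edges := funext fun p =>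
      h'.isCliqueDecomposition.eq_pathWeight hG (p.edges_ne_nil fun _ => ha.not_isSink)
    obtain ⟨rfl, hcc'⟩ := h'.simplex.unique h𝓛 h'.pos hc (hw'.trans hcw.symm)
    exact ⟨rfl, hcc'⟩
  · have hmem : ∀ e, F e ∈ (Int.castAddHom ℝ).range := fun e => (hint e).imp fun _ => Eq.symm
    have hle := DiMultigraph.Framing.closure_range_pathWeight_le (𝓕 := 𝓕) hmem
    exact fun L hL => (hle (hcl L hL)).imp fun _ => Eq.symm
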